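/- Let $A$ be a finite alphabet with $|A|\ge 2$ and let $G$ be a group with a self-similar action over $A$: maps $(g,a)\mapsto g(a)\in A$ and $(g,a)\mapsto g|_a\in G$ such that $(g,a)\mapsto g(a)$ is a group action on $A$, $1|_a=1$ and $(gh)|_a=g|_{h(a)}\,h|_a$; they extend to words by $g(aw)=g(a)\,g|_a(w)$ and $g|_{aw}=(g|_a)|_w$. Assume that $G$ is a weakly regular branch group, i.e. the action on $A^*$ is faithful, it is transitive on the words of each length, and there is a non-trivial subgroup $H\le \mathrm{Stab}_1(G)=\{g: g(a)=a \text{ for all } a\in A\}$ such that for every family $(h_a)_{a\in A}$ in $H$ there is $h\in H$ with $h|_a=h_a$ for all $a\in A$. Let $X=A\times\mathbb N$, with the self-similar action $g(a,i)=(g(a),i)$, $g|_{(a,i)}=g|_a$ (the countable inflation), and let $S$ be the associated inverse semigroup: it consists of $0$ and the elements $ugv^*$ ($u,v\in X^*$, $g\in G$), with product determined by $gx=g(x)g|_x$, $x^*g=g|_{g^{-1}(x)}(g^{-1}(x))^*$, $x^*x=1$ and $x^*y=0$ for letters $x\ne y$. Let $\mathcal G(S)$ be its (contracted) universal groupoid,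 i.e. the groupoid of germs $[s,\theta]$ of the action $(s\theta)(e)=\theta(s^*es)$ of $S$ on the space of characters (non-zero, zero-preserving homomorphisms $E(S)\to\{0,1\}$, with pointwise convergence) of its semilattice of idempotents; its topology has as basis the sets $\{[s,\theta]:\theta\in U\}$ with $s\in S$ and $U$ an open set of characters $\theta$ satisfying $\theta(s^*s)=1$. Then: 1. $S$ is congruence-free (its only congruences are equality and the universal relation), and $E(S)$ is strongly $0$-disjunctive: for every idempotent $e\ne 0$ and all idempotents $e_1,\dots,e_n<e$ there is an idempotent $0\neq f\le e$ with $fe_i=0$ for all $i$. 2. $\mathcal G(S)$ is an ample groupoid (étale, with locally compact Hausdorff unit space having a basis of compact open sets). It is minimal (the unit space has no proper non-empty open invariant subset) and effective (the interior of the isotropy subgroupoid is the unit space). If $G$ is countable, then $\mathcal G(S)$ is second countable. 3. Let $K$ be any field, let $K\mathcal G(S)$ be the Steinberg algebra (the $K$-span of the characteristic functions of the compact local bisections, with convolution) and let $K_0S$ be the contracted semigroup algebra (the $K$-algebra with basis $S\setminus\{0\}$ whose product extends that of $S$, the zero of $S$ being identified with $0$). Then $K\mathcal G(S)$ contains a non-zero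 singular function, i.e. a non-zero element whose support $\{\gamma : f(\gamma)\neq 0\}$ has empty interior; $K\mathcal G(S)\cong K_0S$ as $K$-algebras; and neither $K\mathcal G(S)$ nor $K_0S$ is simple. -/

import Mathlib

namespace BranchGroupoid

/-! ### Inverse semigroups with zero -/

/-- An inverse semigroup with zero: every `s` has exactly one generalised inverse, written
`star s`. -/
class InverseSemigroupWithZero (S : Type*) extends SemigroupWithZero S, Star S where
  mul_star_mul_self : ∀ s : S, s * star s * s = s
  star_mul_self_mul_star : ∀ s : S, star s * s * star s = star s
  star_unique : ∀ s t : S, s * t * s = s → t * s * t = t → t = star s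

namespace InverseSemigroupWithZero

variable {S : Type*} [InverseSemigroupWithZero S]

theorem star_star' (s : S) : star (star s) = s :=
  (star_unique (star s) s (star_mul_self_mul_star s) (mul_star_mul_self s)).symm

theorem star_idem {e : S} (he : e * e = e) : star e = e :=
  (star_unique e e (by rw [he, he]) (by rw [he, he])).symm

theorem idem_star_mul (s : S) : (star s * s) * (star s * s) = star s * s := by
  rw [← mul_assoc, star_mul_self_mul_star]

theorem idem_mul_star (s : S) : (s * star s) * (s * star s) = s * star s := by
  rw [← mul_assoc, mul_star_mul_self]

theorem idem_mul_idem {e f : S} (he : e * e = e) (hf : f * f = f) :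
    (e * f) * (e * f) = e * f := by
  have he' : ∀ z, e * (e * z) = e * z := fun z => by rw [← mul_assoc, he]
  have hf' : ∀ z, f * (f * z) = f * z := fun z => by rw [← mul_assoc, hf]
  have h1 := mul_star_mul_self (e * f)
  have h2 := star_mul_self_mul_star (e * f)
  generalize hx : star (e * f) = x at h1 h2
  have h2' : ∀ z, x * (e * (f * (x * z))) = x * z := fun z => by
    conv_rhs => rw [← h2]
    simp only [mul_assoc]
  have hfxe : f * x * e = x := by
    rw [← hx]
    apply star_unique
    · rw [hx]
      simp only [mul_assoc, he', hf'] at h1 ⊢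
      exact h1
    · rw [hx]
      simp only [mul_assoc, he', hf', h2']
  have hxx : x * x = x := by
    conv_lhs => rw [← hfxe]
    conv_rhs => rw [← hfxe]
    simp only [mul_assoc, h2']
  have : e * f = x := by
    rw [← star_star' (e * f), hx, star_idem hxx]
  rw [this, hxx]

theorem idem_comm {e f : S} (he : e * e = e) (hf : f * f = f) : e * f = f * e := by
  have he' : ∀ z, e * (e * z) = e * z := fun z => by rw [← mul_assoc, he]
  have hf' : ∀ z, f * (f * z) = f * z := fun z => by rw [← mul_assoc, hf]
  have h1 := idem_mul_idem he hf
  have h2 := idem_mul_idem hf he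
  have h3 : f * e = star (e * f) := by
    apply star_unique
    · simp only [mul_assoc, he', hf'] at h1 ⊢
      exact h1
    · simp only [mul_assoc, he', hf'] at h2 ⊢
      exact h2
  rw [h3, star_idem h1]

theorem star_mul_rev (s t : S) : star (s * t) = star t * star s := by
  have hc := idem_comm (idem_star_mul s) (idem_mul_star t)
  have hc' : ∀ z, star s * (s * (t * (star t * z))) = t * (star t * (star s * (s * z))) := fun z => by
    have := congrArg (· * z) hc
    simpa only [mul_assoc] using this
  have h1 : ∀ (s z : S), s * (star s * (s * z)) = s * z := fun s z => by
    rw [← mul_assoc, ← mul_assoc, mul_star_mul_self]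
  have h2 : ∀ (s z : S), star s * (s * (star s * z)) = star s * z := fun s z => by
    rw [← mul_assoc, ← mul_assoc, star_mul_self_mul_star]
  have h3 : ∀ (s : S), s * (star s * s) = s := fun s => by
    rw [← mul_assoc, mul_star_mul_self]
  have h4 : ∀ (s : S), star s * (s * star s) = star s := fun s => by
    rw [← mul_assoc, star_mul_self_mul_star]
  symm
  apply star_unique
  · simp only [mul_assoc]
    rw [← hc', h1]
    rw [h3]
  · simp only [mul_assoc]
    rw [hc', h2, h4]

theorem idem_conj (s : S) {e : S} (he : e * e = e) :
    (star s * e * s) * (star s * e * s) = star s * e * s := by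
  have he' : ∀ z, e * (e * z) = e * z := fun z => by rw [← mul_assoc, he]
  have hc : ∀ z, s * (star s * (e * z)) = e * (s * (star s * z)) := fun z => by
    have := congrArg (· * z) (idem_comm (idem_mul_star s) he)
    simpa only [mul_assoc] using this
  have h3 : ∀ (s : S), s * (star s * s) = s := fun s => by
    rw [← mul_assoc, mul_star_mul_self]
  simp only [mul_assoc]
  rw [hc, he', h3]

theorem conj_mul (s : S) {e f : S} (he : e * e = e) :
    (star s * e * s) * (star s * f * s) = star s * (e * f) * s := by
  have hc : ∀ z, s * (star s * (e * z)) = e * (s * (star s * z)) := fun z => by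
    have := congrArg (· * z) (idem_comm (idem_mul_star s) he)
    simpa only [mul_assoc] using this
  have h2 : ∀ (s z : S), star s * (s * (star s * z)) = star s * z := fun s z => by
    rw [← mul_assoc, ← mul_assoc, star_mul_self_mul_star]
  simp only [mul_assoc]
  rw [← hc, h2]

/-- The natural partial order: `s ≤ t` iff `s = t s^* s`. -/
def NatLE (s t : S) : Prop := s = t * (star s * s)

/-- The set `E(S)` of idempotents. -/
abbrev Idem (S : Type*) [InverseSemigroupWithZero S] : Type _ := {e : S // e * e = e}

/-- The idempotents form a (commutative) subsemigroup. -/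
instance : Mul (Idem S) := ⟨fun e f => ⟨e.1 * f.1, idem_mul_idem e.2 f.2⟩⟩

instance : Zero (Idem S) := ⟨⟨0, mul_zero 0⟩⟩

/-- The idempotent `s^* s`. -/
def src (s : S) : Idem S := ⟨star s * s, idem_star_mul s⟩

/-- The idempotent `s^* e s`. -/
def conj (s : S) (e : Idem S) : Idem S := ⟨star s * e.1 * s, idem_conj s e.2⟩

variable (S) in
/-- `S` is congruence-free: the only congruences are equality and the universal one. -/
def CongruenceFree : Prop := ∀ c : Con S, c = ⊥ ∨ c = ⊤

variable (S) in
/-- The semilattice `E(S)` is strongly `0`-disjunctive: for every idempotent `e ≠ 0` and finitely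
many idempotents `e₁, …, eₙ < e` there is an idempotent `0 ≠ f ≤ e` with `f eᵢ = 0` for all `i`. -/
def StronglyZeroDisjunctive : Prop :=
  ∀ (e : Idem S) (F : Finset (Idem S)), e ≠ 0 → (∀ f ∈ F, f * e = f ∧ f ≠ e) →
    ∃ f : Idem S, f ≠ 0 ∧ f * e = f ∧ ∀ e' ∈ F, f * e' = 0

end InverseSemigroupWithZero

/-! ### Topological groupoids and Steinberg algebras -/

/-- A groupoid, regarded as its set of arrows; an object is identified with the identity arrow at
it. The product `comp a b` is meaningful only when `dom a = ran b`; nothing is required of its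
value on other pairs, and no definition below uses that value. -/
class ArrowGroupoid (𝒢 : Type*) where
  dom : 𝒢 → 𝒢
  ran : 𝒢 → 𝒢
  inv : 𝒢 → 𝒢
  comp : 𝒢 → 𝒢 → 𝒢
  dom_dom : ∀ a, dom (dom a) = dom a
  ran_dom : ∀ a, ran (dom a) = dom a
  dom_ran : ∀ a, dom (ran a) = ran a
  ran_ran : ∀ a, ran (ran a) = ran a
  dom_comp : ∀ a b, dom a = ran b → dom (comp a b) = dom b
  ran_comp : ∀ a b, dom a = ran b → ran (comp a b) = ran a
  comp_dom : ∀ a, comp a (dom a) = a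
  comp_ran : ∀ a, comp (ran a) a = a
  assoc : ∀ a b c, dom a = ran b → dom b = ran c → comp (comp a b) c = comp a (comp b c)
  dom_inv : ∀ a, dom (inv a) = ran a
  ran_inv : ∀ a, ran (inv a) = dom a
  inv_comp : ∀ a, comp (inv a) a = dom a
  comp_inv : ∀ a, comp a (inv a) = ran a

section Groupoid

set_option linter.unusedSectionVars false

open ArrowGroupoid

variable (𝒢 : Type*) [ArrowGroupoid 𝒢]

/-- The unit space `𝒢⁰`; it carries the subspace topology. -/
def unitSpace : Set 𝒢 := Set.range (dom : 𝒢 → 𝒢)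

/-- The isotropy subgroupoid. -/
def isotropy : Set 𝒢 := {a | (dom a : 𝒢) = ran a}

variable {𝒢} in
/-- The domain map, with values in the unit space. -/
def domUnit (a : 𝒢) : unitSpace 𝒢 := ⟨dom a, a, rfl⟩

variable {𝒢} in
theorem ran_mem_unitSpace (a : 𝒢) : (ran a : 𝒢) ∈ unitSpace 𝒢 := ⟨inv a, dom_inv a⟩

variable {𝒢} in
/-- The range map, with values in the unit space. -/
def ranUnit (a : 𝒢) : unitSpace 𝒢 := ⟨ran a, ran_mem_unitSpace a⟩

variable {𝒢} in
theorem comp_inv_comp {a b : 𝒢} (h : (dom a : 𝒢) = ran b) : comp (inv a) (comp a b) = b := by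
  rw [← assoc _ _ _ (dom_inv a) h, inv_comp, h, comp_ran]

variable {𝒢} in
theorem comp_comp_inv {a b : 𝒢} (h : (dom a : 𝒢) = ran b) : comp (comp a b) (inv b) = a := by
  rw [assoc _ _ _ h (ran_inv b).symm, comp_inv, ← h, comp_dom]

variable {𝒢} in
theorem comp_comp_of_ran {a b : 𝒢} (h : (ran a : 𝒢) = ran b) : comp a (comp (inv a) b) = b := by
  rw [← assoc _ _ _ (ran_inv a).symm ((dom_inv a).trans h), comp_inv, h, comp_ran]

variable {𝒢} in
theorem inv_inv' (a : 𝒢) : inv (inv a) = a := by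
  have h := comp_inv_comp (a := inv a) (b := a) (dom_inv a)
  rwa [inv_comp, ← ran_inv a, ← dom_inv (inv a), comp_dom] at h

variable [TopologicalSpace 𝒢]

/-- A topological groupoid: the structure maps are continuous (the product on the set of composable
pairs). -/
class IsTopologicalGroupoid : Prop where
  continuous_dom : Continuous (dom : 𝒢 → 𝒢)
  continuous_ran : Continuous (ran : 𝒢 → 𝒢)
  continuous_inv : Continuous (inv : 𝒢 → 𝒢)
  continuousOn_comp : ContinuousOn (fun p : 𝒢 × 𝒢 => comp p.1 p.2) {p | (dom p.1 : 𝒢) = ran p.2}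

/-- An ample groupoid: an étale groupoid (the domain map is a local homeomorphism onto the unit
space) whose unit space is locally compact, Hausdorff, and has a basis of compact open sets.
The groupoid itself need not be Hausdorff. -/
class IsAmpleGroupoid : Prop extends IsTopologicalGroupoid 𝒢 where
  isLocalHomeomorph_dom : IsLocalHomeomorph (domUnit : 𝒢 → unitSpace 𝒢)
  t2Space_units : T2Space (unitSpace 𝒢)
  locallyCompactSpace_units : LocallyCompactSpace (unitSpace 𝒢)
  basis_units : TopologicalSpace.IsTopologicalBasis
    {U : Set (unitSpace 𝒢) | IsOpen U ∧ IsCompact U}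

/-- Minimality: the unit space has no proper non-empty open invariant subset. -/
def IsMinimalGroupoid : Prop :=
  ∀ V : Set (unitSpace 𝒢), IsOpen V → (∀ a : 𝒢, domUnit a ∈ V ↔ ranUnit a ∈ V) →
    V = ∅ ∨ V = Set.univ

/-- Effectiveness: the interior of the isotropy subgroupoid is the unit space. -/
def IsEffectiveGroupoid : Prop := interior (isotropy 𝒢) = unitSpace 𝒢

variable {𝒢}

/-- A compact local bisection: a compact open set on which the domain and the range maps are
homeomorphisms onto their images. -/
structure IsCompactBisection (U : Set 𝒢) : Prop where
  isOpen : IsOpen U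
  isCompact : IsCompact U
  isEmbedding_dom : Topology.IsEmbedding (U.domRestrict (dom : 𝒢 → 𝒢))
  isEmbedding_ran : Topology.IsEmbedding (U.domRestrict (ran : 𝒢 → 𝒢))

/-- The product of two sets of arrows. -/
def setComp (U V : Set 𝒢) : Set 𝒢 :=
  {c | ∃ a ∈ U, ∃ b ∈ V, (dom a : 𝒢) = ran b ∧ comp a b = c}

theorem IsCompactBisection.injOn_dom {U : Set 𝒢} (hU : IsCompactBisection U) :
    Set.InjOn (dom : 𝒢 → 𝒢) U := Set.injOn_iff_injective.2 hU.isEmbedding_dom.injective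

theorem IsCompactBisection.injOn_ran {U : Set 𝒢} (hU : IsCompactBisection U) :
    Set.InjOn (ran : 𝒢 → 𝒢) U := Set.injOn_iff_injective.2 hU.isEmbedding_ran.injective

section Ample

variable [IsAmpleGroupoid 𝒢]

theorem isLocalHomeomorph_ran : IsLocalHomeomorph (ranUnit : 𝒢 → unitSpace 𝒢) := by
  have hc := IsTopologicalGroupoid.continuous_inv (𝒢 := 𝒢)
  let e : 𝒢 ≃ₜ 𝒢 :=
    { toFun := inv, invFun := inv, left_inv := inv_inv', right_inv := inv_inv',
      continuous_toFun := hc, continuous_invFun := hc }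
  have : (ranUnit : 𝒢 → unitSpace 𝒢) = domUnit ∘ e := by
    funext a
    exact Subtype.ext (dom_inv a).symm
  rw [this]
  exact IsAmpleGroupoid.isLocalHomeomorph_dom.comp e.isLocalHomeomorph

theorem isEmbedding_restrict {f : 𝒢 → unitSpace 𝒢} (hf : IsLocalHomeomorph f) {U : Set 𝒢}
    (hU : IsOpen U) (hi : Set.InjOn f U) :
    Topology.IsEmbedding (U.domRestrict (fun a => (f a : 𝒢))) := by
  have h1 : Topology.IsOpenEmbedding (U.domRestrict f) :=
    .of_continuous_injective_isOpenMap (hf.continuous.comp continuous_subtype_val)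
      (Set.injOn_iff_injective.1 hi) (hf.isOpenMap.domRestrict hU)
  exact Topology.IsEmbedding.subtypeVal.comp h1.isEmbedding

theorem isOpen_setComp {U V : Set 𝒢} (hU : IsCompactBisection U) (hV : IsCompactBisection V) :
    IsOpen (setComp U V) := by
  classical
  have hr : IsLocalHomeomorph (ranUnit : 𝒢 → unitSpace 𝒢) := isLocalHomeomorph_ran
  let A : Set 𝒢 := ranUnit ⁻¹' (ranUnit '' U)
  have hA : IsOpen A := (hr.isOpenMap _ hU.isOpen).preimage hr.continuous
  let τ : 𝒢 → 𝒢 := fun c => if h : ∃ a ∈ U, (ran a : 𝒢) = ran c then h.choose else c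
  have hτ : ∀ c ∈ A, τ c ∈ U ∧ (ran (τ c) : 𝒢) = ran c := by
    rintro c ⟨a, ha, hac⟩
    have h : ∃ a ∈ U, (ran a : 𝒢) = ran c := ⟨a, ha, congrArg Subtype.val hac⟩
    simp only [τ, dif_pos h]
    exact h.choose_spec
  have hτc : ContinuousOn τ A := by
    rw [continuousOn_open_iff hA]
    intro N hN
    have : A ∩ τ ⁻¹' N = ranUnit ⁻¹' (ranUnit '' (U ∩ N)) := by
      ext c
      constructor
      · rintro ⟨hc, hN'⟩
        exact ⟨τ c, ⟨(hτ c hc).1, hN'⟩, Subtype.ext (hτ c hc).2⟩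
      · rintro ⟨a, ⟨ha, haN⟩, hac⟩
        have hc : c ∈ A := ⟨a, ha, hac⟩
        refine ⟨hc, ?_⟩
        have : τ c = a := hU.injOn_ran (hτ c hc).1 ha
          ((hτ c hc).2.trans (congrArg Subtype.val hac).symm)
        rw [Set.mem_preimage, this]
        exact haN
    rw [this]
    exact (hr.isOpenMap _ (hU.isOpen.inter hN)).preimage hr.continuous
  have hcont : ContinuousOn (fun c => comp (inv (τ c)) c) A := by
    have h1 : ContinuousOn (fun c => ((inv (τ c), c) : 𝒢 × 𝒢)) A :=
      (IsTopologicalGroupoid.continuous_inv.comp_continuousOn hτc).prodMk continuousOn_id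
    refine IsTopologicalGroupoid.continuousOn_comp.comp h1 ?_
    intro c hc
    exact (dom_inv _).trans (hτ c hc).2
  have : setComp U V = A ∩ (fun c => comp (inv (τ c)) c) ⁻¹' V := by
    ext c
    constructor
    · rintro ⟨a, ha, b, hb, hab, rfl⟩
      have hc : comp a b ∈ A := ⟨a, ha, Subtype.ext (ran_comp a b hab).symm⟩
      refine ⟨hc, ?_⟩
      have : τ (comp a b) = a := hU.injOn_ran (hτ _ hc).1 ha
          ((hτ _ hc).2.trans (ran_comp a b hab))
      simp only [Set.mem_preimage, this, comp_inv_comp hab]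
      exact hb
    · rintro ⟨hc, hV'⟩
      refine ⟨τ c, (hτ c hc).1, _, hV', ?_, comp_comp_of_ran (hτ c hc).2⟩
      rw [ran_comp _ _ ((dom_inv _).trans (hτ c hc).2), ran_inv]
  rw [this]
  exact hcont.isOpen_inter_preimage hA hV.isOpen

theorem IsCompactBisection.setComp {U V : Set 𝒢} (hU : IsCompactBisection U)
    (hV : IsCompactBisection V) : IsCompactBisection (setComp U V) := by
  have ho := isOpen_setComp hU hV
  refine ⟨ho, ?_, ?_, ?_⟩
  · have := IsAmpleGroupoid.t2Space_units (𝒢 := 𝒢)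
    have hd : Continuous (domUnit : 𝒢 → unitSpace 𝒢) :=
      IsAmpleGroupoid.isLocalHomeomorph_dom.continuous
    have hr : Continuous (ranUnit : 𝒢 → unitSpace 𝒢) := isLocalHomeomorph_ran.continuous
    have hcl : IsClosed {p : 𝒢 × 𝒢 | domUnit p.1 = ranUnit p.2} :=
      isClosed_eq (hd.comp continuous_fst) (hr.comp continuous_snd)
    have hk := (hU.isCompact.prod hV.isCompact).inter_right hcl
    have : BranchGroupoid.setComp U V = (fun p : 𝒢 × 𝒢 => comp p.1 p.2) ''
        (U ×ˢ V ∩ {p : 𝒢 × 𝒢 | domUnit p.1 = ranUnit p.2}) := by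
      ext c
      constructor
      · rintro ⟨a, ha, b, hb, hab, rfl⟩
        exact ⟨(a, b), ⟨⟨ha, hb⟩, Subtype.ext hab⟩, rfl⟩
      · rintro ⟨⟨a, b⟩, ⟨⟨ha, hb⟩, hab⟩, rfl⟩
        exact ⟨a, ha, b, hb, congrArg Subtype.val hab, rfl⟩
    rw [this]
    refine hk.image_of_continuousOn (IsTopologicalGroupoid.continuousOn_comp.mono ?_)
    rintro p ⟨-, hp⟩
    exact congrArg Subtype.val hp
  · refine isEmbedding_restrict IsAmpleGroupoid.isLocalHomeomorph_dom ho ?_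
    rintro _ ⟨a, ha, b, hb, hab, rfl⟩ _ ⟨a', ha', b', hb', hab', rfl⟩ h
    have h' := congrArg Subtype.val h
    simp only [domUnit, dom_comp _ _ hab, dom_comp _ _ hab'] at h'
    obtain rfl := hV.injOn_dom hb hb' h'
    obtain rfl := hU.injOn_dom ha ha' (hab.trans hab'.symm)
    rfl
  · refine isEmbedding_restrict isLocalHomeomorph_ran ho ?_
    rintro _ ⟨a, ha, b, hb, hab, rfl⟩ _ ⟨a', ha', b', hb', hab', rfl⟩ h
    have h' := congrArg Subtype.val h
    simp only [ranUnit, ran_comp _ _ hab, ran_comp _ _ hab'] at h'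
    obtain rfl := hU.injOn_ran ha ha' h'
    obtain rfl := hV.injOn_ran hb hb' (hab.symm.trans hab')
    rfl

end Ample

theorem setComp_assoc (U V W : Set 𝒢) :
    setComp (setComp U V) W = setComp U (setComp V W) := by
  ext c
  constructor
  · rintro ⟨_, ⟨a, ha, b, hb, hab, rfl⟩, d, hd, hbd, rfl⟩
    rw [dom_comp _ _ hab] at hbd
    exact ⟨a, ha, _, ⟨b, hb, d, hd, hbd, rfl⟩, hab.trans (ran_comp _ _ hbd).symm,
      (assoc _ _ _ hab hbd).symm⟩
  · rintro ⟨a, ha, _, ⟨b, hb, d, hd, hbd, rfl⟩, hab, rfl⟩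
    rw [ran_comp _ _ hbd] at hab
    exact ⟨_, ⟨a, ha, b, hb, hab, rfl⟩, d, hd, (dom_comp _ _ hab).trans hbd,
      assoc _ _ _ hab hbd⟩

variable (K : Type*) [CommRing K]

/-- The characteristic function of a set of arrows. -/
noncomputable def charFun (U : Set 𝒢) : 𝒢 → K := U.indicator 1

variable {K} in
/-- Convolution: `(f * g)(c)` is the sum of `f(a) g(b)` over all factorisations `c = ab`. -/
noncomputable def conv (f g : 𝒢 → K) (c : 𝒢) : K :=
  ∑ᶠ p : {p : 𝒢 × 𝒢 // (dom p.1 : 𝒢) = ran p.2 ∧ comp p.1 p.2 = c}, f p.1.1 * g p.1.2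

variable (𝒢) in
/-- The `K`-span of the characteristic functions of the compact local bisections. -/
noncomputable def steinbergSubmodule : Submodule K (𝒢 → K) :=
  Submodule.span K {f | ∃ U : Set 𝒢, IsCompactBisection U ∧ f = charFun K U}

variable (𝒢) in
/-- The Steinberg algebra `K𝒢` (its product is convolution). -/
def SteinbergAlgebra : Type _ := steinbergSubmodule 𝒢 K

noncomputable instance : AddCommGroup (SteinbergAlgebra 𝒢 K) :=
  inferInstanceAs (AddCommGroup (steinbergSubmodule 𝒢 K))

noncomputable instance : Module K (SteinbergAlgebra 𝒢 K) :=
  inferInstanceAs (Module K (steinbergSubmodule 𝒢 K))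

variable {K}

/-- An element of the Steinberg algebra is singular if its support has empty interior. -/
def IsSingularFunction (f : SteinbergAlgebra 𝒢 K) : Prop :=
  interior (Function.support f.1) = ∅

theorem charFun_mem {U : Set 𝒢} (hU : IsCompactBisection U) :
    charFun K U ∈ steinbergSubmodule 𝒢 K := Submodule.subset_span ⟨U, hU, rfl⟩

theorem steinberg_induction {P : (f : 𝒢 → K) → f ∈ steinbergSubmodule 𝒢 K → Prop}
    (h1 : ∀ U : Set 𝒢, ∀ hU : IsCompactBisection U, P (charFun K U) (charFun_mem hU))
    (h0 : P 0 (Submodule.zero_mem _))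
    (ha : ∀ f g hf hg, P f hf → P g hg → P (f + g) (Submodule.add_mem _ hf hg))
    (hs : ∀ (k : K) f hf, P f hf → P (k • f) (Submodule.smul_mem _ k hf))
    (f : 𝒢 → K) (hf : f ∈ steinbergSubmodule 𝒢 K) : P f hf := by
  refine Submodule.span_induction (p := fun f hf => P f hf) ?_ h0 ha hs hf
  rintro _ ⟨U, hU, rfl⟩
  exact h1 U hU

theorem finite_fibre (f : 𝒢 → K) (hf : f ∈ steinbergSubmodule 𝒢 K) (x : 𝒢) :
    {a : 𝒢 | (ran a : 𝒢) = x ∧ f a ≠ 0}.Finite := by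
  induction f, hf using steinberg_induction with
  | h1 U hU =>
    apply Set.Subsingleton.finite
    rintro a ⟨ha, ha'⟩ b ⟨hb, hb'⟩
    have key : ∀ c, charFun K U c ≠ 0 → c ∈ U := fun c h => Set.mem_of_indicator_ne_zero h
    exact hU.injOn_ran (key a ha') (key b hb') (ha.trans hb.symm)
  | h0 => simp
  | ha f g _ _ hf hg =>
    refine (hf.union hg).subset ?_
    rintro a ⟨ha, ha'⟩
    by_cases h : f a = 0
    · exact Or.inr ⟨ha, fun h' => ha' (by simp [h, h'])⟩
    · exact Or.inl ⟨ha, h⟩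
  | hs k f _ hf =>
    refine hf.subset ?_
    rintro a ⟨ha, ha'⟩
    exact ⟨ha, fun h => ha' (by simp [h])⟩

theorem conv_finite (f : 𝒢 → K) (hf : f ∈ steinbergSubmodule 𝒢 K) (g : 𝒢 → K) (c : 𝒢) :
    (Function.support fun p : {p : 𝒢 × 𝒢 // (dom p.1 : 𝒢) = ran p.2 ∧ comp p.1 p.2 = c} =>
      f p.1.1 * g p.1.2).Finite := by
  refine Set.Finite.of_finite_image (f := fun p => p.1.1)
    ((finite_fibre f hf (ran c)).subset ?_) ?_
  · rintro _ ⟨⟨⟨a, b⟩, hab, rfl⟩, hp, rfl⟩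
    exact ⟨(ran_comp a b hab).symm, fun h => hp (by simp only at h; simp [h])⟩
  · rintro ⟨⟨a, b⟩, hab, rfl⟩ - ⟨⟨a', b'⟩, hab', h⟩ - (rfl : a = a')
    have : b = b' := by
      have h1 := comp_inv_comp hab
      have h2 := comp_inv_comp hab'
      rw [h] at h2
      exact h1.symm.trans h2
    subst this
    rfl

theorem conv_add {f : 𝒢 → K} (hf : f ∈ steinbergSubmodule 𝒢 K) (g h : 𝒢 → K) :
    conv f (g + h) = conv f g + conv f h := by
  funext c
  simp only [conv, Pi.add_apply, mul_add]
  exact finsum_add_distrib (conv_finite f hf g c) (conv_finite f hf h c)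

theorem add_conv {f g : 𝒢 → K} (hf : f ∈ steinbergSubmodule 𝒢 K)
    (hg : g ∈ steinbergSubmodule 𝒢 K) (h : 𝒢 → K) :
    conv (f + g) h = conv f h + conv g h := by
  funext c
  simp only [conv, Pi.add_apply, add_mul]
  exact finsum_add_distrib (conv_finite f hf h c) (conv_finite g hg h c)

theorem smul_conv (k : K) {f : 𝒢 → K} (hf : f ∈ steinbergSubmodule 𝒢 K) (g : 𝒢 → K) :
    conv (k • f) g = k • conv f g := by
  funext c
  simp only [conv, Pi.smul_apply, smul_eq_mul, mul_assoc]
  exact (mul_finsum' _ k (conv_finite f hf g c)).symm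

theorem conv_smul (k : K) {f : 𝒢 → K} (hf : f ∈ steinbergSubmodule 𝒢 K) (g : 𝒢 → K) :
    conv f (k • g) = k • conv f g := by
  rw [← smul_conv k hf]
  funext c
  simp only [conv, Pi.smul_apply, smul_eq_mul]
  exact finsum_congr fun p => by ring

theorem zero_conv (f : 𝒢 → K) : conv 0 f = 0 := by
  funext c
  simp [conv]

theorem conv_zero (f : 𝒢 → K) : conv f 0 = 0 := by
  funext c
  simp [conv]

theorem charFun_conv {U V : Set 𝒢} (hU : IsCompactBisection U) :
    conv (charFun K U) (charFun K V) = charFun K (setComp U V) := by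
  classical
  funext c
  have hm : ∀ a b : 𝒢, charFun K U a * charFun K V b = if a ∈ U ∧ b ∈ V then 1 else 0 := by
    intro a b
    by_cases ha : a ∈ U <;> by_cases hb : b ∈ V <;> simp [charFun, ha, hb]
  simp only [conv, hm]
  by_cases hc : c ∈ setComp U V
  · obtain ⟨a, ha, b, hb, hab, rfl⟩ := hc
    rw [finsum_eq_single _ ⟨(a, b), hab, rfl⟩]
    · have : comp a b ∈ setComp U V := ⟨a, ha, b, hb, hab, rfl⟩
      simp [charFun, ha, hb, this]
    · rintro ⟨⟨a', b'⟩, hab', h⟩ hne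
      rw [if_neg]
      rintro ⟨ha' : a' ∈ U, -⟩
      apply hne
      have h1 : a' = a := hU.injOn_ran ha' ha (by
        rw [← ran_comp a' b' hab', ← ran_comp a b hab]; exact congrArg ran h)
      subst h1
      have : b' = b := by
        have h1 := comp_inv_comp hab
        have h2 := comp_inv_comp hab'
        rw [h] at h2
        exact h2.symm.trans h1
      subst this
      rfl
  · have : charFun K (setComp U V) c = 0 := by simp [charFun, hc]
    rw [this]
    refine (finsum_congr ?_).trans finsum_zero
    rintro ⟨⟨a, b⟩, hab, h⟩
    refine if_neg ?_
    rintro ⟨h1, h2⟩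
    exact hc ⟨a, h1, b, h2, hab, h⟩

variable [IsAmpleGroupoid 𝒢]

theorem conv_mem {f g : 𝒢 → K} (hf : f ∈ steinbergSubmodule 𝒢 K)
    (hg : g ∈ steinbergSubmodule 𝒢 K) : conv f g ∈ steinbergSubmodule 𝒢 K := by
  induction f, hf using steinberg_induction with
  | h1 U hU =>
    induction g, hg using steinberg_induction with
    | h1 V hV => rw [charFun_conv hU]; exact charFun_mem (hU.setComp hV)
    | h0 => rw [conv_zero]; exact Submodule.zero_mem _
    | ha f g _ _ hf hg => rw [conv_add (charFun_mem hU)]; exact Submodule.add_mem _ hf hg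
    | hs k f _ hf => rw [conv_smul k (charFun_mem hU)]; exact Submodule.smul_mem _ _ hf
  | h0 => rw [zero_conv]; exact Submodule.zero_mem _
  | ha f g hf' hg' hf hg => rw [add_conv hf' hg']; exact Submodule.add_mem _ hf hg
  | hs k f hf' hf => rw [smul_conv k hf']; exact Submodule.smul_mem _ _ hf

theorem conv_assoc {f g h : 𝒢 → K} (hf : f ∈ steinbergSubmodule 𝒢 K)
    (hg : g ∈ steinbergSubmodule 𝒢 K) (hh : h ∈ steinbergSubmodule 𝒢 K) :
    conv (conv f g) h = conv f (conv g h) := by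
  induction f, hf using steinberg_induction with
  | h1 U hU =>
    have mU := charFun_mem (K := K) hU
    induction g, hg using steinberg_induction with
    | h1 V hV =>
      have mV := charFun_mem (K := K) hV
      induction h, hh using steinberg_induction with
      | h1 W hW =>
        rw [charFun_conv hU, charFun_conv hV, charFun_conv hU, charFun_conv (hU.setComp hV),
          setComp_assoc]
      | h0 => simp only [conv_zero]
      | ha f g _ _ hf hg => rw [conv_add (conv_mem mU mV), conv_add mV, conv_add mU, hf, hg]
      | hs k f _ hf => rw [conv_smul k (conv_mem mU mV), conv_smul k mV, conv_smul k mU, hf]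
    | h0 => simp only [conv_zero, zero_conv]
    | ha f g hf' hg' hf hg =>
      rw [conv_add mU, add_conv (conv_mem mU hf') (conv_mem mU hg'), add_conv hf' hg',
        conv_add mU, hf, hg]
    | hs k f hf' hf =>
      rw [conv_smul k mU, smul_conv k (conv_mem mU hf'), smul_conv k hf', conv_smul k mU, hf]
  | h0 => simp only [zero_conv]
  | ha f g hf' hg' hf hg =>
    rw [add_conv hf' hg', add_conv (conv_mem hf' ‹_›) (conv_mem hg' ‹_›), add_conv hf' hg', hf, hg]
  | hs k f hf' hf =>
    rw [smul_conv k hf', smul_conv k (conv_mem hf' ‹_›), smul_conv k hf', hf]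

noncomputable instance : NonUnitalRing (SteinbergAlgebra 𝒢 K) :=
  { (inferInstance : AddCommGroup (SteinbergAlgebra 𝒢 K)) with
    mul := fun f g => ⟨conv f.1 g.1, conv_mem f.2 g.2⟩
    left_distrib := fun f g h => Subtype.ext (conv_add f.2 g.1 h.1)
    right_distrib := fun f g h => Subtype.ext (add_conv f.2 g.2 h.1)
    zero_mul := fun f => Subtype.ext (zero_conv f.1)
    mul_zero := fun f => Subtype.ext (conv_zero f.1)
    mul_assoc := fun f g h => Subtype.ext (conv_assoc f.2 g.2 h.2) }

instance : IsScalarTower K (SteinbergAlgebra 𝒢 K) (SteinbergAlgebra 𝒢 K) :=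
  ⟨fun k f g => Subtype.ext (smul_conv k f.2 g.1)⟩

instance : SMulCommClass K (SteinbergAlgebra 𝒢 K) (SteinbergAlgebra 𝒢 K) :=
  ⟨fun k f g => Subtype.ext (conv_smul k f.2 g.1).symm⟩

end Groupoid

/-! ### The universal groupoid of an inverse semigroup with zero -/

open InverseSemigroupWithZero

/-- A character of `E(S)`: a non-zero, zero-preserving homomorphism `E(S) → {0, 1}`. -/
@[ext]
structure Character (S : Type*) [InverseSemigroupWithZero S] where
  toFun : Idem S → Bool
  map_zero : toFun 0 = false
  map_mul : ∀ e f : Idem S, toFun (e * f) = (toFun e && toFun f)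
  nonzero : ∃ e : Idem S, toFun e = true

section UniversalGroupoid

variable {S : Type*} [InverseSemigroupWithZero S]

/-- The topology of pointwise convergence on the spectrum. -/
instance : TopologicalSpace (Character S) := TopologicalSpace.induced Character.toFun inferInstance

/-- The action of `s` on the characters in its domain `D(s^* s)`: `(s θ)(e) = θ(s^* e s)`. -/
def Character.act (θ : Character S) (s : S) (h : θ.toFun (src s) = true) : Character S where
  toFun e := θ.toFun (conj s e)
  map_zero := by
    rw [← θ.map_zero]
    congr 1
    exact Subtype.ext ((congrArg (· * s) (mul_zero (star s))).trans (zero_mul s))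
  map_mul e f := by
    rw [← θ.map_mul]
    congr 1
    exact Subtype.ext (conj_mul s e.2).symm
  nonzero := by
    refine ⟨⟨s * star s, idem_mul_star s⟩, ?_⟩
    rw [← h]
    congr 1
    refine Subtype.ext ?_
    simp only [conj, src]
    rw [← mul_assoc, star_mul_self_mul_star]

/-- Pairs `(s, θ)` with `θ` in the domain `D(s^* s)` of `s`. -/
structure PreGerm (S : Type*) [InverseSemigroupWithZero S] where
  elt : S
  pt : Character S
  mem : pt.toFun (src elt) = true

/-- `(s, θ) ∼ (t, η)` iff `θ = η` and there is `u ≤ s, t` with `θ` in the domain of `u`. -/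
def PreGerm.Rel (a b : PreGerm S) : Prop :=
  a.pt = b.pt ∧ ∃ u : S, NatLE u a.elt ∧ NatLE u b.elt ∧ a.pt.toFun (src u) = true

theorem PreGerm.rel_iff (a b : PreGerm S) :
    a.Rel b ↔ a.pt = b.pt ∧
      ∃ e : Idem S, a.pt.toFun e = true ∧ a.elt * e.1 = b.elt * e.1 := by
  constructor
  · rintro ⟨h, u, hua, hub, hu⟩
    exact ⟨h, src u, hu, hua.symm.trans hub⟩
  · rintro ⟨h, e, he, hab⟩
    have key : star (a.elt * e.1) * (a.elt * e.1) = star a.elt * a.elt * e.1 := by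
      rw [star_mul_rev, star_idem e.2]
      have := idem_comm e.2 (idem_star_mul a.elt)
      calc e.1 * star a.elt * (a.elt * e.1) = e.1 * (star a.elt * a.elt) * e.1 := by
            simp only [mul_assoc]
        _ = star a.elt * a.elt * e.1 := by rw [this, mul_assoc, e.2]
    have key2 : star a.elt * a.elt * e.1 = e.1 * (star a.elt * a.elt) :=
      idem_comm (idem_star_mul a.elt) e.2
    refine ⟨h, a.elt * e.1, ?_, ?_, ?_⟩
    · unfold NatLE
      rw [key, ← mul_assoc, ← mul_assoc, mul_star_mul_self]
    · unfold NatLE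
      rw [key, key2, ← mul_assoc, ← hab, mul_assoc, ← key2, ← mul_assoc, ← mul_assoc,
        mul_star_mul_self]
    · have : src (a.elt * e.1) = src a.elt * e := Subtype.ext key
      rw [this, a.pt.map_mul, a.mem, he]
      rfl

/-- The equivalence relation defining germs. -/
instance germSetoid (S : Type*) [InverseSemigroupWithZero S] : Setoid (PreGerm S) where
  r := PreGerm.Rel
  iseqv :=
    { refl := fun a => (PreGerm.rel_iff a a).2 ⟨rfl, src a.elt, a.mem, rfl⟩
      symm := by
        rintro a b ⟨h, u, h1, h2, h3⟩
        exact ⟨h.symm, u, h2, h1, h ▸ h3⟩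
      trans := by
        intro a b c hab hbc
        rw [PreGerm.rel_iff] at hab hbc ⊢
        obtain ⟨h, e, he, hab⟩ := hab
        obtain ⟨h', f, hf, hbc⟩ := hbc
        refine ⟨h.trans h', e * f, ?_, ?_⟩
        · rw [a.pt.map_mul, he, h, hf]
          rfl
        · change a.elt * (e.1 * f.1) = c.elt * (e.1 * f.1)
          rw [← mul_assoc, hab, idem_comm e.2 f.2, ← mul_assoc, ← hbc, mul_assoc, mul_assoc,
            idem_comm e.2 f.2] }

/-- The (contracted) universal groupoid `𝒢(S)`: the groupoid of germs of the action of `S` on the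
spectrum of `E(S)`. -/
def UniversalGroupoid (S : Type*) [InverseSemigroupWithZero S] : Type _ := Quotient (germSetoid S)

/-- The germ `[s, θ]`. -/
def germ (s : S) (θ : Character S) (h : θ.toFun (src s) = true) : UniversalGroupoid S :=
  Quotient.mk (germSetoid S) ⟨s, θ, h⟩

theorem germ_eq_iff {s t : S} {θ η : Character S} {h : θ.toFun (src s) = true}
    {h' : η.toFun (src t) = true} :
    germ s θ h = germ t η h' ↔
      θ = η ∧ ∃ e : Idem S, θ.toFun e = true ∧ s * e.1 = t * e.1 :=
  Quotient.eq.trans (PreGerm.rel_iff _ _)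

theorem germ_surj (a : UniversalGroupoid S) : ∃ s θ h, a = germ s θ h := by
  obtain ⟨⟨s, θ, h⟩, rfl⟩ := Quotient.exists_rep a
  exact ⟨s, θ, h, rfl⟩

theorem conj_mul_left (s t : S) (e : Idem S) : conj (s * t) e = conj t (conj s e) := by
  refine Subtype.ext ?_
  simp only [conj, star_mul_rev, mul_assoc]

theorem conj_src (s t : S) : conj t (src s) = src (s * t) := by
  refine Subtype.ext ?_
  simp only [conj, src, star_mul_rev, mul_assoc]

theorem conj_idem (e f : Idem S) : conj e.1 f = e * f := by
  refine Subtype.ext ?_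
  change star e.1 * f.1 * e.1 = e.1 * f.1
  rw [star_idem e.2, mul_assoc, idem_comm f.2 e.2, ← mul_assoc, e.2]

theorem src_idem (e : Idem S) : src e.1 = e := by
  refine Subtype.ext ?_
  change star e.1 * e.1 = e.1
  rw [star_idem e.2, e.2]

theorem PreGerm.act_eq {a b : PreGerm S} (h : a.Rel b) :
    a.pt.act a.elt a.mem = b.pt.act b.elt b.mem := by
  rw [PreGerm.rel_iff] at h
  obtain ⟨h, e, he, hab⟩ := h
  ext f
  change a.pt.toFun (conj a.elt f) = b.pt.toFun (conj b.elt f)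
  have h1 : ∀ s : S, a.pt.toFun (conj (s * e.1) f) = a.pt.toFun (conj s f) := by
    intro s
    rw [conj_mul_left, conj_idem, a.pt.map_mul, he, Bool.true_and]
  rw [← h, ← h1, ← h1 b.elt, hab]

/-- The domain of a germ, as a character: `[s, θ] ↦ θ`. -/
def UniversalGroupoid.source (a : UniversalGroupoid S) : Character S :=
  Quotient.lift (fun a : PreGerm S => a.pt) (fun a b (h : a.Rel b) => h.1) a

/-- The range of a germ, as a character: `[s, θ] ↦ s θ`. -/
def UniversalGroupoid.target (a : UniversalGroupoid S) : Character S :=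
  Quotient.lift (fun a : PreGerm S => a.pt.act a.elt a.mem) (fun _ _ h => PreGerm.act_eq h) a

/-- The identity germ at a character `θ`: it is `[e, θ]` for any idempotent `e` with `θ(e) = 1`. -/
noncomputable def unitGerm (θ : Character S) : UniversalGroupoid S :=
  germ θ.nonzero.choose.1 θ (by rw [src_idem]; exact θ.nonzero.choose_spec)

theorem unitGerm_eq (θ : Character S) (e : Idem S) (h : θ.toFun (src e.1) = true) :
    germ e.1 θ h = unitGerm θ := by
  rw [src_idem] at h
  refine germ_eq_iff.2 ⟨rfl, e * θ.nonzero.choose, ?_, ?_⟩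
  · rw [θ.map_mul, h, θ.nonzero.choose_spec]
    rfl
  · change e.1 * (e.1 * θ.nonzero.choose.1) = θ.nonzero.choose.1 * (e.1 * θ.nonzero.choose.1)
    rw [← mul_assoc, e.2, idem_comm e.2 θ.nonzero.choose.2, ← mul_assoc, θ.nonzero.choose.2]

theorem source_unitGerm (θ : Character S) : (unitGerm θ).source = θ := rfl

theorem target_unitGerm (θ : Character S) : (unitGerm θ).target = θ := by
  ext f
  change θ.toFun (conj θ.nonzero.choose.1 f) = _
  rw [conj_idem, θ.map_mul, θ.nonzero.choose_spec, Bool.true_and]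

theorem unitGerm_inj {θ η : Character S} : unitGerm θ = unitGerm η ↔ θ = η :=
  ⟨fun h => congrArg UniversalGroupoid.source h, fun h => h ▸ rfl⟩

theorem mem_mul {s t : S} {θ : Character S} (ht : θ.toFun (src t) = true)
    (hs : (θ.act t ht).toFun (src s) = true) : θ.toFun (src (s * t)) = true := by
  rw [← conj_src]
  exact hs

open Classical in
/-- The product `[s, tθ][t, θ] = [st, θ]`; the value on non-composable pairs is irrelevant. -/
noncomputable def PreGerm.comp (a b : PreGerm S) : PreGerm S :=
  if h : a.pt = b.pt.act b.elt b.mem then ⟨a.elt * b.elt, b.pt, mem_mul b.mem (h ▸ a.mem)⟩ else b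

theorem PreGerm.comp_rel (a a' : PreGerm S) (ha : a.Rel a') (b b' : PreGerm S) (hb : b.Rel b') :
    (a.comp b).Rel (a'.comp b') := by
  by_cases h : a.pt = b.pt.act b.elt b.mem
  · have h' : a'.pt = b'.pt.act b'.elt b'.mem := by rw [← PreGerm.act_eq hb, ← h, ha.1]
    rw [PreGerm.comp, PreGerm.comp, dif_pos h, dif_pos h']
    rw [PreGerm.rel_iff] at ha hb ⊢
    obtain ⟨-, e, he, hae⟩ := ha
    obtain ⟨hb, f, hf, hbf⟩ := hb
    refine ⟨hb, f * conj b.elt e, ?_, ?_⟩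
    · change b.pt.toFun _ = true
      rw [b.pt.map_mul, hf, Bool.true_and]
      rw [h] at he
      exact he
    · change a.elt * b.elt * (f.1 * (conj b.elt e).1) = a'.elt * b'.elt * (f.1 * (conj b.elt e).1)
      have h1 : ∀ z, b'.elt * (f.1 * z) = b.elt * (f.1 * z) := fun z => by
        rw [← mul_assoc, ← hbf, mul_assoc]
      have h2 : b.elt * (f.1 * (conj b.elt e).1) = e.1 * (b.elt * f.1) := by
        rw [idem_comm f.2 (conj b.elt e).2]
        change b.elt * (star b.elt * e.1 * b.elt * f.1) = _
        have := idem_comm (idem_mul_star b.elt) e.2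
        calc b.elt * (star b.elt * e.1 * b.elt * f.1)
            = (b.elt * star b.elt * e.1) * (b.elt * f.1) := by simp only [mul_assoc]
          _ = e.1 * ((b.elt * star b.elt * b.elt) * f.1) := by rw [this]; simp only [mul_assoc]
          _ = _ := by rw [mul_star_mul_self]
      rw [mul_assoc, mul_assoc, h1, h2, ← mul_assoc, ← mul_assoc, hae]
      simp only [mul_assoc]
  · have h' : ¬ a'.pt = b'.pt.act b'.elt b'.mem := by rwa [← PreGerm.act_eq hb, ← ha.1]
    rw [PreGerm.comp, PreGerm.comp, dif_neg h, dif_neg h']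
    exact hb

theorem mem_star {s : S} {θ : Character S} (hs : θ.toFun (src s) = true) :
    (θ.act s hs).toFun (src (star s)) = true := by
  rw [← hs]
  change θ.toFun (conj s (src (star s))) = _
  rw [conj_src, src, src]
  congr 1
  refine Subtype.ext ?_
  change star (star s * s) * (star s * s) = star s * s
  rw [star_idem (idem_star_mul s), idem_star_mul]

/-- The inverse `[s, θ]⁻¹ = [s^*, sθ]`. -/
def PreGerm.inv (a : PreGerm S) : PreGerm S := ⟨star a.elt, a.pt.act a.elt a.mem, mem_star a.mem⟩

theorem PreGerm.inv_rel (a b : PreGerm S) (h : a.Rel b) : a.inv.Rel b.inv := by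
  have hact := PreGerm.act_eq h
  rw [PreGerm.rel_iff] at h ⊢
  obtain ⟨-, e, he, hab⟩ := h
  refine ⟨hact, conj (star a.elt) e, ?_, ?_⟩
  · change a.pt.toFun (conj a.elt (conj (star a.elt) e)) = true
    rw [← conj_mul_left]
    change a.pt.toFun (conj (src a.elt).1 e) = true
    rw [conj_idem, a.pt.map_mul, a.mem, he]
    rfl
  · change star a.elt * (star (star a.elt) * e.1 * star a.elt) =
      star b.elt * (star (star a.elt) * e.1 * star a.elt)
    rw [star_star']
    have hs : e.1 * star a.elt = e.1 * star b.elt := by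
      have := congrArg star hab
      rwa [star_mul_rev, star_mul_rev, star_idem e.2] at this
    have h1 : ∀ s : S, star s * (s * e.1 * star s) = e.1 * star s := by
      intro s
      calc star s * (s * e.1 * star s) = (star s * s * e.1) * star s := by simp only [mul_assoc]
        _ = e.1 * (star s * s * star s) := by
          rw [idem_comm (idem_star_mul s) e.2]; simp only [mul_assoc]
        _ = _ := by rw [star_mul_self_mul_star]
    have h2 : a.elt * e.1 * star a.elt = b.elt * e.1 * star b.elt := by
      rw [mul_assoc, hs, ← mul_assoc, hab]
    rw [h1, h2, h1, hs]

/-- The product of germs. -/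
noncomputable def UniversalGroupoid.comp (a b : UniversalGroupoid S) : UniversalGroupoid S :=
  Quotient.map₂ PreGerm.comp PreGerm.comp_rel a b

/-- The inverse of a germ. -/
def UniversalGroupoid.inv (a : UniversalGroupoid S) : UniversalGroupoid S :=
  Quotient.map PreGerm.inv PreGerm.inv_rel a

theorem UniversalGroupoid.comp_germ {s t : S} {θ η : Character S} {hs : η.toFun (src s) = true}
    {ht : θ.toFun (src t) = true} (h : η = θ.act t ht) :
    UniversalGroupoid.comp (germ s η hs) (germ t θ ht) =
      germ (s * t) θ (mem_mul ht (h ▸ hs)) := by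
  change Quotient.mk _ (PreGerm.comp ⟨s, η, hs⟩ ⟨t, θ, ht⟩) = _
  rw [PreGerm.comp, dif_pos h]
  rfl

noncomputable instance (S : Type*) [InverseSemigroupWithZero S] :
    ArrowGroupoid (UniversalGroupoid S) where
  dom a := unitGerm a.source
  ran a := unitGerm a.target
  inv := UniversalGroupoid.inv
  comp := UniversalGroupoid.comp
  dom_dom a := by rw [source_unitGerm]
  ran_dom a := by rw [target_unitGerm]
  dom_ran a := by rw [source_unitGerm]
  ran_ran a := by rw [target_unitGerm]
  dom_comp a b h := by
    obtain ⟨s, η, hs, rfl⟩ := germ_surj a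
    obtain ⟨t, θ, ht, rfl⟩ := germ_surj b
    rw [unitGerm_inj] at h
    change η = θ.act t ht at h
    rw [UniversalGroupoid.comp_germ h]
    rfl
  ran_comp a b h := by
    obtain ⟨s, η, hs, rfl⟩ := germ_surj a
    obtain ⟨t, θ, ht, rfl⟩ := germ_surj b
    rw [unitGerm_inj] at h
    change η = θ.act t ht at h
    rw [UniversalGroupoid.comp_germ h, unitGerm_inj]
    subst h
    ext e
    change θ.toFun (conj (s * t) e) = θ.toFun (conj t (conj s e))
    rw [conj_mul_left]
  comp_dom a := by
    obtain ⟨s, η, hs, rfl⟩ := germ_surj a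
    change UniversalGroupoid.comp (germ s η hs) (unitGerm η) = _
    rw [← unitGerm_eq η (src s) (by rw [src_idem]; exact hs), UniversalGroupoid.comp_germ]
    · refine germ_eq_iff.2 ⟨rfl, src s, hs, ?_⟩
      change s * (star s * s) * (star s * s) = s * (star s * s)
      rw [mul_assoc, idem_star_mul]
    · ext e
      change _ = η.toFun (conj (src s).1 e)
      rw [conj_idem, η.map_mul, hs, Bool.true_and]
  comp_ran a := by
    obtain ⟨s, η, hs, rfl⟩ := germ_surj a
    change UniversalGroupoid.comp (unitGerm (η.act s hs)) (germ s η hs) = _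
    rw [← unitGerm_eq (η.act s hs) (src (star s)) (by rw [src_idem]; exact mem_star hs),
      UniversalGroupoid.comp_germ rfl]
    refine germ_eq_iff.2 ⟨rfl, src s, hs, ?_⟩
    change star (star s) * star s * s * (star s * s) = s * (star s * s)
    rw [star_star', mul_star_mul_self]
  assoc a b c hab hbc := by
    obtain ⟨s, η, hs, rfl⟩ := germ_surj a
    obtain ⟨t, θ, ht, rfl⟩ := germ_surj b
    obtain ⟨u, κ, hu, rfl⟩ := germ_surj c
    rw [unitGerm_inj] at hab hbc
    change η = θ.act t ht at hab
    change θ = κ.act u hu at hbc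
    rw [UniversalGroupoid.comp_germ hab, UniversalGroupoid.comp_germ hbc,
      UniversalGroupoid.comp_germ hbc, UniversalGroupoid.comp_germ]
    · simp only [mul_assoc]
    · subst hbc
      subst hab
      ext e
      change κ.toFun (conj u (conj t e)) = κ.toFun (conj (t * u) e)
      rw [conj_mul_left]
  dom_inv a := by
    obtain ⟨s, η, hs, rfl⟩ := germ_surj a
    rfl
  ran_inv a := by
    obtain ⟨s, η, hs, rfl⟩ := germ_surj a
    rw [unitGerm_inj]
    ext e
    change η.toFun (conj s (conj (star s) e)) = η.toFun e
    rw [← conj_mul_left]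
    change η.toFun (conj (src s).1 e) = η.toFun e
    rw [conj_idem, η.map_mul, hs, Bool.true_and]
  inv_comp a := by
    obtain ⟨s, η, hs, rfl⟩ := germ_surj a
    change UniversalGroupoid.comp
      (germ (star s) (η.act s hs) (mem_star hs)) (germ s η hs) = unitGerm η
    rw [UniversalGroupoid.comp_germ rfl]
    exact unitGerm_eq η (src s) _
  comp_inv a := by
    obtain ⟨s, η, hs, rfl⟩ := germ_surj a
    change UniversalGroupoid.comp (germ s η hs)
      (germ (star s) (η.act s hs) (mem_star hs)) = unitGerm (η.act s hs)
    rw [UniversalGroupoid.comp_germ]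
    · exact unitGerm_eq (η.act s hs) ⟨s * star s, idem_mul_star s⟩ _
    · ext e
      change η.toFun e = η.toFun (conj s (conj (star s) e))
      rw [← conj_mul_left]
      change η.toFun e = η.toFun (conj (src s).1 e)
      rw [conj_idem, η.map_mul, hs, Bool.true_and]

/-- The set `(s, U)` of the germs `[s, θ]` with `θ ∈ U`. -/
def germSet (s : S) (U : Set (Character S)) : Set (UniversalGroupoid S) :=
  {a | ∃ θ h, θ ∈ U ∧ a = germ s θ h}

/-- The topology with basis the sets `(s, U)`, where `s ∈ S` and `U ⊆ D(s^* s)` is open. -/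
instance (S : Type*) [InverseSemigroupWithZero S] : TopologicalSpace (UniversalGroupoid S) :=
  TopologicalSpace.generateFrom
    {B | ∃ (s : S) (U : Set (Character S)), IsOpen U ∧ U ⊆ {θ | θ.toFun (src s) = true} ∧
      B = germSet s U}

end UniversalGroupoid

/-! ### Contracted semigroup algebras -/

section ContractedAlgebra

variable (K : Type*) [CommRing K] (S : Type*) [SemigroupWithZero S]

namespace ContractedAlgebra

variable {S}

open Classical in
/-- The natural map from `S` to the free `K`-module on `S ∖ {0}`: it sends `0` to `0` and `s ≠ 0` to
the basis element `s`. -/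
noncomputable def basisElt (s : S) : {s : S // s ≠ 0} →₀ K :=
  if h : s = 0 then 0 else Finsupp.single ⟨s, h⟩ 1

variable {K}

/-- The bilinear extension of the product of `S` (with the zero of `S` identified with `0`). -/
noncomputable def mulFun (a b : {s : S // s ≠ 0} →₀ K) : {s : S // s ≠ 0} →₀ K :=
  a.sum fun s x => b.sum fun t y => (x * y) • basisElt K (s.1 * t.1)

theorem zero_mulFun (a : {s : S // s ≠ 0} →₀ K) : mulFun 0 a = 0 := Finsupp.sum_zero_index

theorem mulFun_zero (a : {s : S // s ≠ 0} →₀ K) : mulFun a 0 = 0 :=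
  Finset.sum_eq_zero fun _ _ => Finsupp.sum_zero_index

theorem add_mulFun (a b c : {s : S // s ≠ 0} →₀ K) :
    mulFun (a + b) c = mulFun a c + mulFun b c := by
  classical
  refine Finsupp.sum_add_index' ?_ ?_
  · intro s
    simp [Finsupp.sum]
  · intro s x y
    simp only [add_mul, add_smul]
    exact Finsupp.sum_add

theorem mulFun_add (a b c : {s : S // s ≠ 0} →₀ K) :
    mulFun a (b + c) = mulFun a b + mulFun a c := by
  classical
  unfold mulFun
  rw [← Finsupp.sum_add]
  refine Finsupp.sum_congr fun s _ => ?_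
  refine Finsupp.sum_add_index' ?_ ?_
  · intro t
    simp
  · intro t x y
    simp only [mul_add, add_smul]

theorem smul_mulFun (k : K) (a b : {s : S // s ≠ 0} →₀ K) :
    mulFun (k • a) b = k • mulFun a b := by
  refine (Finsupp.sum_smul_index' ?_).trans ?_
  · intro s
    simp [Finsupp.sum]
  · simp only [mulFun, Finsupp.sum, Finset.smul_sum, smul_smul, smul_eq_mul, mul_assoc]

theorem mulFun_smul (k : K) (a b : {s : S // s ≠ 0} →₀ K) :
    mulFun a (k • b) = k • mulFun a b := by
  unfold mulFun
  rw [Finsupp.smul_sum]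
  refine Finsupp.sum_congr fun s _ => ?_
  refine (Finsupp.sum_smul_index' ?_).trans ?_
  · intro s
    simp
  · simp only [Finsupp.sum, Finset.smul_sum, smul_smul, smul_eq_mul]
    refine Finset.sum_congr rfl fun t _ => ?_
    congr 1
    ring

theorem basisElt_zero : basisElt K (0 : S) = 0 := dif_pos rfl

theorem mulFun_basisElt (s t : S) :
    mulFun (basisElt K s) (basisElt K t) = basisElt K (s * t) := by
  by_cases hs : s = 0
  · rw [hs, basisElt_zero, zero_mulFun, zero_mul, basisElt_zero]
  by_cases ht : t = 0
  · rw [ht, basisElt_zero, mulFun_zero, mul_zero, basisElt_zero]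
  have h1 : basisElt K s = Finsupp.single ⟨s, hs⟩ 1 := dif_neg hs
  have h2 : basisElt K t = Finsupp.single ⟨t, ht⟩ 1 := dif_neg ht
  rw [h1, h2, mulFun, Finsupp.sum_single_index, Finsupp.sum_single_index]
  · simp
  · simp
  · simp [Finsupp.sum]

theorem basis_induction {P : ({s : S // s ≠ 0} →₀ K) → Prop} (h0 : P 0)
    (ha : ∀ a b, P a → P b → P (a + b)) (hs : ∀ (k : K) s, P (k • basisElt K s))
    (a : {s : S // s ≠ 0} →₀ K) : P a := by
  refine Finsupp.induction_linear a h0 ha fun s k => ?_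
  have h := hs k s.1
  have h1 : basisElt K s.1 = Finsupp.single s 1 := dif_neg s.2
  rwa [h1, Finsupp.smul_single, smul_eq_mul, mul_one] at h

theorem mulFun_assoc (a b c : {s : S // s ≠ 0} →₀ K) :
    mulFun (mulFun a b) c = mulFun a (mulFun b c) := by
  induction a using basis_induction with
  | h0 => simp only [zero_mulFun]
  | ha a a' h h' => simp only [add_mulFun, h, h']
  | hs k s =>
    induction b using basis_induction with
    | h0 => simp only [zero_mulFun, mulFun_zero]
    | ha a a' h h' => simp only [mulFun_add, add_mulFun, h, h']
    | hs l t =>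
      induction c using basis_induction with
      | h0 => simp only [mulFun_zero]
      | ha a a' h h' => simp only [mulFun_add, h, h']
      | hs m u => simp only [smul_mulFun, mulFun_smul, mulFun_basisElt, mul_assoc]

end ContractedAlgebra

/-- The contracted semigroup algebra `K₀S`: the `K`-algebra with basis `S ∖ {0}` whose product
extends that of `S`. -/
def ContractedAlgebra : Type _ := {s : S // s ≠ 0} →₀ K

noncomputable instance : AddCommGroup (ContractedAlgebra K S) :=
  inferInstanceAs (AddCommGroup ({s : S // s ≠ 0} →₀ K))

noncomputable instance : Module K (ContractedAlgebra K S) :=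
  inferInstanceAs (Module K ({s : S // s ≠ 0} →₀ K))

noncomputable instance : NonUnitalRing (ContractedAlgebra K S) :=
  { (inferInstance : AddCommGroup (ContractedAlgebra K S)) with
    mul := ContractedAlgebra.mulFun
    left_distrib := ContractedAlgebra.mulFun_add
    right_distrib := ContractedAlgebra.add_mulFun
    zero_mul := ContractedAlgebra.zero_mulFun
    mul_zero := ContractedAlgebra.mulFun_zero
    mul_assoc := ContractedAlgebra.mulFun_assoc }

instance : IsScalarTower K (ContractedAlgebra K S) (ContractedAlgebra K S) :=
  ⟨ContractedAlgebra.smul_mulFun⟩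

instance : SMulCommClass K (ContractedAlgebra K S) (ContractedAlgebra K S) :=
  ⟨fun k a b => (ContractedAlgebra.mulFun_smul k a b).symm⟩

end ContractedAlgebra

/-! ### Self-similar groups, their inverse semigroups, and weakly regular branch groups -/

/-- A self-similar action of the group `G` over the alphabet `X`: letters `g(x)` and sections
`g|_x`, subject to the laws below. -/
structure SelfSimilarAction (G X : Type*) [Group G] where
  act : G → X → X
  sec : G → X → G
  one_act : ∀ x, act 1 x = x
  mul_act : ∀ g h x, act (g * h) x = act g (act h x)
  one_sec : ∀ x, sec 1 x = 1
  mul_sec : ∀ g h x, sec (g * h) x = sec g (act h x) * sec h x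

namespace SelfSimilarAction

variable {G X : Type*} [Group G] (σ : SelfSimilarAction G X)

/-- The action on words: `g(xw) = g(x) g|_x(w)`. -/
def actWord : G → List X → List X
  | _, [] => []
  | g, x :: w => σ.act g x :: actWord (σ.sec g x) w

/-- The sections at words: `g|_{xw} = (g|_x)|_w`. -/
def secWord : G → List X → G
  | g, [] => g
  | g, x :: w => secWord (σ.sec g x) w

@[simp] theorem actWord_nil (g : G) : σ.actWord g [] = [] := rfl

@[simp] theorem secWord_nil (g : G) : σ.secWord g [] = g := rfl

theorem actWord_one (w : List X) : σ.actWord 1 w = w := by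
  induction w with
  | nil => rfl
  | cons x w ih => simp [actWord, σ.one_act, σ.one_sec, ih]

theorem secWord_one (w : List X) : σ.secWord 1 w = 1 := by
  induction w with
  | nil => rfl
  | cons x w ih => simp [secWord, σ.one_sec, ih]

theorem actWord_mul (g h : G) (w : List X) :
    σ.actWord (g * h) w = σ.actWord g (σ.actWord h w) := by
  induction w generalizing g h with
  | nil => rfl
  | cons x w ih => simp [actWord, σ.mul_act, σ.mul_sec, ih]

theorem secWord_mul (g h : G) (w : List X) :
    σ.secWord (g * h) w = σ.secWord g (σ.actWord h w) * σ.secWord h w := by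
  induction w generalizing g h with
  | nil => rfl
  | cons x w ih => simp [actWord, secWord, σ.mul_sec, ih]

theorem actWord_append (g : G) (u w : List X) :
    σ.actWord g (u ++ w) = σ.actWord g u ++ σ.actWord (σ.secWord g u) w := by
  induction u generalizing g with
  | nil => rfl
  | cons x u ih => simp [actWord, secWord, ih]

theorem secWord_append (g : G) (u w : List X) :
    σ.secWord g (u ++ w) = σ.secWord (σ.secWord g u) w := by
  induction u generalizing g with
  | nil => rfl
  | cons x u ih => simp [secWord, ih]

theorem actWord_inv_actWord (g : G) (w : List X) : σ.actWord g⁻¹ (σ.actWord g w) = w := by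
  rw [← actWord_mul, inv_mul_cancel, actWord_one]

theorem actWord_actWord_inv (g : G) (w : List X) : σ.actWord g (σ.actWord g⁻¹ w) = w := by
  rw [← actWord_mul, mul_inv_cancel, actWord_one]

theorem secWord_inv (g : G) (w : List X) : σ.secWord g⁻¹ (σ.actWord g w) = (σ.secWord g w)⁻¹ := by
  rw [eq_inv_iff_mul_eq_one, ← secWord_mul, inv_mul_cancel, secWord_one]

/-- The action is faithful: `G` acts faithfully on words. -/
def Faithful : Prop := ∀ g : G, (∀ w : List X, σ.actWord g w = w) → g = 1

/-- Spherical transitivity: `G` is transitive on the words of each given length. -/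
def SphericallyTransitive : Prop :=
  ∀ v w : List X, v.length = w.length → ∃ g : G, σ.actWord g v = w

/-- The stabiliser of the first level. -/
def stabOne : Subgroup G where
  carrier := {g | ∀ x, σ.act g x = x}
  one_mem' := σ.one_act
  mul_mem' := by
    intro g h hg hh x
    rw [σ.mul_act, hh x, hg x]
  inv_mem' := by
    intro g hg x
    have h := σ.mul_act g⁻¹ g x
    rw [inv_mul_cancel, σ.one_act, hg x] at h
    exact h.symm

/-- A weakly regular branch group: a self-similar (faithful) group that is spherically transitive
and has a non-trivial subgroup `H ≤ Stab₁(G)` such that every family `(f a)` of elements of `H`,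
indexed by the letters, is the family of first-level sections of some element of `H`. -/
structure IsWeaklyRegularBranch : Prop where
  faithful : σ.Faithful
  sphericallyTransitive : σ.SphericallyTransitive
  branches : ∃ H : Subgroup G, H ≤ σ.stabOne ∧ H ≠ ⊥ ∧
    ∀ f : X → G, (∀ x, f x ∈ H) → ∃ h ∈ H, ∀ x, σ.sec h x = f x

/-- The countable inflation: the action over the alphabet `X × ℕ` with `g(x, i) = (g(x), i)` and
`g|_{(x, i)} = g|_x`. -/
def countableInflation : SelfSimilarAction G (X × ℕ) where
  act g x := (σ.act g x.1, x.2)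
  sec g x := σ.sec g x.1
  one_act x := by rw [σ.one_act]
  mul_act g h x := by rw [σ.mul_act]
  one_sec x := σ.one_sec x.1
  mul_sec g h x := σ.mul_sec g h x.1

end SelfSimilarAction

/-- The elements of the inverse semigroup of a self-similar action: a zero, and the formal
expressions `u g v^*` with `u`, `v` words and `g ∈ G`. -/
inductive SelfSimilarSemigroup {G X : Type*} [Group G] (σ : SelfSimilarAction G X) : Type _
  | zero : SelfSimilarSemigroup σ
  | elt (u : List X) (g : G) (v : List X) : SelfSimilarSemigroup σ

namespace SelfSimilarSemigroup

variable {G X : Type*} [Group G] {σ : SelfSimilarAction G X}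

open Classical in
/-- The product. With `p`, `q` words, `u g v^* · v p h z^* = u g(p) g|_p h z^*` and
`u g (w q)^* · w h z^* = u g h|_r (z r)^*` where `r = h⁻¹(q)`; if neither of `v`, `w` is a prefix of
the other, then `u g v^* · w h z^* = 0`. -/
noncomputable def mul : SelfSimilarSemigroup σ → SelfSimilarSemigroup σ → SelfSimilarSemigroup σ
  | elt u g v, elt w h z =>
    if v <+: w then
      elt (u ++ σ.actWord g (w.drop v.length)) (σ.secWord g (w.drop v.length) * h) z
    else if w <+: v then
      elt u (g * σ.secWord h (σ.actWord h⁻¹ (v.drop w.length)))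
        (z ++ σ.actWord h⁻¹ (v.drop w.length))
    else zero
  | _, _ => zero

/-- The inverse `(u g v^*)^* = v g⁻¹ u^*`. -/
def inv : SelfSimilarSemigroup σ → SelfSimilarSemigroup σ
  | zero => zero
  | elt u g v => elt v g⁻¹ u

theorem mul_of_prefix (u v p z : List X) (g h : G) :
    mul (elt u g v : SelfSimilarSemigroup σ) (elt (v ++ p) h z) =
      elt (u ++ σ.actWord g p) (σ.secWord g p * h) z := by
  simp [mul]

theorem mul_of_prefix' (u w q z : List X) (g h : G) :
    mul (elt u g (w ++ q) : SelfSimilarSemigroup σ) (elt w h z) =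
      elt u (g * σ.secWord h (σ.actWord h⁻¹ q)) (z ++ σ.actWord h⁻¹ q) := by
  by_cases hq : q = []
  · subst hq
    simp [mul]
  · have : ¬ (w ++ q) <+: w := by
      intro hp
      have := hp.length_le
      rw [List.length_append] at this
      exact hq (List.length_eq_zero_iff.1 (by omega))
    simp only [mul, if_neg this, if_pos (List.prefix_append w q), List.drop_left]

/-- The graph of the partial injective map by which an element acts on the monoid `X^* G`:
`u g v^*` sends `v p k` to `u g(p) g|_p k`. -/
def Graph : SelfSimilarSemigroup σ → List X × G → List X × G → Prop
  | zero, _, _ => False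
  | elt u g v, m, n => ∃ p k, m = (v ++ p, k) ∧ n = (u ++ σ.actWord g p, σ.secWord g p * k)

theorem graph_functional {s : SelfSimilarSemigroup σ} {m n n' : List X × G} (h : s.Graph m n)
    (h' : s.Graph m n') : n = n' := by
  cases s with
  | zero => exact h.elim
  | elt u g v =>
    obtain ⟨p, k, rfl, rfl⟩ := h
    obtain ⟨p', k', h1, rfl⟩ := h'
    simp only [Prod.mk.injEq, List.append_cancel_left_eq] at h1
    obtain ⟨rfl, rfl⟩ := h1
    rfl

theorem graph_inv (s : SelfSimilarSemigroup σ) (m n : List X × G) :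
    (inv s).Graph m n ↔ s.Graph n m := by
  have key : ∀ (u v : List X) (g : G) m n, (elt u g v : SelfSimilarSemigroup σ).Graph m n →
      (elt v g⁻¹ u : SelfSimilarSemigroup σ).Graph n m := by
    rintro u v g _ _ ⟨p, k, rfl, rfl⟩
    refine ⟨σ.actWord g p, σ.secWord g p * k, rfl, ?_⟩
    rw [σ.actWord_inv_actWord, σ.secWord_inv, inv_mul_cancel_left]
  cases s with
  | zero => exact Iff.rfl
  | elt u g v =>
    refine ⟨fun h => ?_, key u v g n m⟩
    have := key v u g⁻¹ m n h
    rwa [inv_inv] at this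

theorem graph_injective {s : SelfSimilarSemigroup σ} {m m' n : List X × G} (h : s.Graph m n)
    (h' : s.Graph m' n) : m = m' :=
  graph_functional ((graph_inv s n m).2 h) ((graph_inv s n m').2 h')

theorem graph_mul (s t : SelfSimilarSemigroup σ) (m n : List X × G) :
    (mul s t).Graph m n ↔ ∃ l, t.Graph m l ∧ s.Graph l n := by
  cases s with
  | zero =>
    constructor
    · intro h
      exact h.elim
    · rintro ⟨l, -, h⟩
      exact h.elim
  | elt u g v =>
    cases t with
    | zero =>
      constructor
      · intro h
        exact h.elim
      · rintro ⟨l, h, -⟩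
        exact h.elim
    | elt w h z =>
      by_cases h1 : v <+: w
      · obtain ⟨r, rfl⟩ := h1
        rw [mul_of_prefix]
        constructor
        · rintro ⟨p, k, rfl, rfl⟩
          refine ⟨_, ⟨p, k, rfl, rfl⟩, r ++ σ.actWord h p, σ.secWord h p * k, ?_, ?_⟩
          · rw [List.append_assoc]
          · rw [σ.actWord_append, σ.secWord_append, σ.actWord_mul, σ.secWord_mul,
              List.append_assoc, mul_assoc]
        · rintro ⟨_, ⟨p, k, rfl, rfl⟩, q, k', h2, rfl⟩
          simp only [Prod.mk.injEq, List.append_assoc, List.append_cancel_left_eq] at h2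
          obtain ⟨rfl, rfl⟩ := h2
          refine ⟨p, k, rfl, ?_⟩
          rw [σ.actWord_append, σ.secWord_append, σ.actWord_mul, σ.secWord_mul,
              List.append_assoc, mul_assoc]
      · by_cases h2 : w <+: v
        · obtain ⟨r, rfl⟩ := h2
          rw [mul_of_prefix']
          have hr : σ.actWord h (σ.actWord h⁻¹ r) = r := σ.actWord_actWord_inv h r
          generalize σ.actWord h⁻¹ r = r' at hr
          subst hr
          constructor
          · rintro ⟨p, k, rfl, rfl⟩
            refine ⟨_, ⟨r' ++ p, k, by rw [List.append_assoc], rfl⟩,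
              σ.actWord (σ.secWord h r') p, σ.secWord (σ.secWord h r') p * k, ?_, ?_⟩
            · rw [σ.actWord_append, σ.secWord_append, List.append_assoc]
            · rw [σ.actWord_mul, σ.secWord_mul, mul_assoc]
          · rintro ⟨_, ⟨p, k, rfl, rfl⟩, q, k', h3, rfl⟩
            simp only [Prod.mk.injEq, List.append_assoc, List.append_cancel_left_eq] at h3
            obtain ⟨h3, rfl⟩ := h3
            have h4 : p = r' ++ σ.actWord (σ.secWord h r')⁻¹ q := by
              have := congrArg (σ.actWord h⁻¹) h3
              rw [σ.actWord_inv_actWord, σ.actWord_append, σ.actWord_inv_actWord,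
                σ.secWord_inv] at this
              exact this
            have hq : σ.actWord (σ.secWord h r') (σ.actWord (σ.secWord h r')⁻¹ q) = q :=
              σ.actWord_actWord_inv _ q
            generalize σ.actWord (σ.secWord h r')⁻¹ q = q' at h4 hq
            subst h4
            subst hq
            refine ⟨q', k, by rw [List.append_assoc], ?_⟩
            rw [σ.secWord_append, σ.actWord_mul, σ.secWord_mul, mul_assoc]
        · have : mul (elt u g v : SelfSimilarSemigroup σ) (elt w h z) = zero := by
            simp [mul, h1, h2]
          rw [this]
          constructor
          · intro h
            exact h.elim
          · rintro ⟨_, ⟨p, k, rfl, rfl⟩, q, k', h3, rfl⟩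
            simp only [Prod.mk.injEq] at h3
            rcases List.append_eq_append_iff.1 h3.1 with ⟨a, ha, -⟩ | ⟨a, ha, -⟩
            · exact (h2 ⟨a, ha.symm⟩).elim
            · exact (h1 ⟨a, ha.symm⟩).elim

theorem graph_ext {s t : SelfSimilarSemigroup σ} (h : ∀ m n, s.Graph m n ↔ t.Graph m n) :
    s = t := by
  have self : ∀ (u v : List X) (g : G),
      (elt u g v : SelfSimilarSemigroup σ).Graph (v, 1) (u, g) :=
    fun u v g => ⟨[], 1, by simp, by simp⟩
  cases s with
  | zero =>
    cases t with
    | zero => rfl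
    | elt u g v => exact ((h _ _).2 (self u v g)).elim
  | elt u g v =>
    cases t with
    | zero => exact ((h _ _).1 (self u v g)).elim
    | elt u' g' v' =>
      obtain ⟨p, k, h1, h2⟩ := (h _ _).1 (self u v g)
      obtain ⟨q, l, h3, h4⟩ := (h _ _).2 (self u' v' g')
      simp only [Prod.mk.injEq] at h1 h2 h3 h4
      have hp : p = [] := by
        have := congrArg List.length h1.1
        have h5 := congrArg List.length h3.1
        rw [List.length_append] at this h5
        exact List.length_eq_zero_iff.1 (by omega)
      subst hp
      obtain ⟨h1, rfl⟩ := h1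
      simp only [List.append_nil, SelfSimilarAction.actWord_nil, SelfSimilarAction.secWord_nil,
        mul_one] at h1 h2
      obtain ⟨rfl, rfl⟩ := h2
      rw [h1]

noncomputable instance : InverseSemigroupWithZero (SelfSimilarSemigroup σ) where
  mul := mul
  zero := zero
  star := inv
  zero_mul s := rfl
  mul_zero s := by cases s <;> rfl
  mul_assoc s t r := by
    refine graph_ext fun m n => ?_
    change (mul (mul s t) r).Graph m n ↔ (mul s (mul t r)).Graph m n
    simp only [graph_mul]
    constructor
    · rintro ⟨a, ha, b, hb, hc⟩
      exact ⟨b, ⟨a, ha, hb⟩, hc⟩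
    · rintro ⟨b, ⟨a, ha, hb⟩, hc⟩
      exact ⟨a, ha, b, hb, hc⟩
  mul_star_mul_self s := by
    refine graph_ext fun m n => ?_
    change (mul (mul s (inv s)) s).Graph m n ↔ _
    simp only [graph_mul, graph_inv]
    constructor
    · rintro ⟨a, ha, b, hb, hc⟩
      rwa [graph_injective ha hb]
    · intro h
      exact ⟨n, h, m, h, h⟩
  star_mul_self_mul_star s := by
    refine graph_ext fun m n => ?_
    change (mul (mul (inv s) s) (inv s)).Graph m n ↔ (inv s).Graph m n
    simp only [graph_mul, graph_inv]
    constructor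
    · rintro ⟨a, ha, b, hb, hc⟩
      rwa [graph_functional ha hb]
    · intro h
      exact ⟨n, h, m, h, h⟩
  star_unique s t h1 h2 := by
    have key : ∀ s t : SelfSimilarSemigroup σ, mul (mul s t) s = s → ∀ m n, s.Graph m n →
        t.Graph n m := by
      intro s t h m n hs
      have hs' := hs
      rw [← h, graph_mul] at hs'
      obtain ⟨a, ha, hb⟩ := hs'
      rw [graph_mul] at hb
      obtain ⟨b, hb, hc⟩ := hb
      rw [graph_functional hs ha, graph_injective hs hc]
      exact hb
    refine graph_ext fun m n => ?_
    rw [graph_inv]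
    exact ⟨key t s h2 m n, key s t h1 n m⟩

end SelfSimilarSemigroup

end BranchGroupoid

open BranchGroupoid

/-! Write X = A × ℕ. The non-zero idempotents of S are the ww*, and the product of vv* and ww*
belongs to the longer word if one is a prefix of the other and is 0 otherwise. A character is
therefore a finite or infinite word over X, seen through its set of prefixes, and ugv* replaces an
initial v by u and lets g act on the rest.

Since X is infinite, the finitely many negative conditions in a basic neighbourhood exclude only
finitely many letters after a given word. Hence every non-empty open set of characters contains the
whole cylinder of some word wx (`exists_letter_forall_notMem`, `support_subset_basicSet`). Strong
0-disjunctivity is the same letter choice. Minimality follows because the element with u = wx, g = 1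
and v empty moves every character into that cylinder. For effectiveness, an open set of isotropy
germs of ugv* tests the action on enough words to force, by faithfulness, ugv* to be idempotent
below some vp. Congruence-freeness is algebraic: a non-trivial congruence can be compressed by words
until it identifies 1 with 0.

For any inverse semigroup with zero, sending s to the characteristic function of all its germs
identifies the contracted algebra with the Steinberg algebra of the universal groupoid
(`germHom_bijective`). It is injective because the germ of s at the principal character of s*s lies
only in the germ sets of elements above s, and surjective by a compactness argument.

The branch condition gives p and q in H whose first-level sections are trivial except for one h ≠ 1,
at a for p and at b ≠ a for q. The function f = (1 - p)(1 - q) = 1 - p - q + pq vanishes at every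
germ whose source begins with some letter, since over that letter p or q has the same germs as 1. So
f is supported over the empty word alone, which is not an isolated point, and f is singular; but f
takes the value 1 at the unit over the empty word. The infinite words form an invariant set of
characters, so the functions vanishing over them form an ideal. It contains f ≠ 0 and does not
contain the identity, so neither algebra is simple. -/

namespace BranchGroupoid

open InverseSemigroupWithZero ArrowGroupoid Topology

/-! ### The spectrum of the idempotents. -/

section UniversalGroupoidTopology

variable {S : Type*} [InverseSemigroupWithZero S]

namespace Character

theorem toFun_injective : Function.Injective (toFun : Character S → Idem S → Bool) :=
  fun _ _ h => Character.ext h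

theorem isInducing_toFun : IsInducing (toFun : Character S → Idem S → Bool) := ⟨rfl⟩

theorem continuous_eval (e : Idem S) : Continuous fun θ : Character S => θ.toFun e :=
  (continuous_apply e).comp isInducing_toFun.continuous

/-- The compact open set `D(e)` of characters with `θ(e) = 1`. -/
def support (e : Idem S) : Set (Character S) := {θ | θ.toFun e = true}

theorem isClopen_support (e : Idem S) : IsClopen (support e) :=
  (isClopen_discrete {true}).preimage (continuous_eval e)

theorem isCompact_support (e : Idem S) : IsCompact (support e) := by
  rw [isInducing_toFun.isCompact_iff]
  -- The condition φ(e) = 1 already makes φ non-zero, so all that is left are closed conditions in a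
  -- compact product.
  have : toFun '' support e = {φ : Idem S → Bool | φ 0 = false} ∩
      (⋂ f : Idem S, ⋂ g : Idem S, {φ : Idem S → Bool | φ (f * g) = (φ f && φ g)}) ∩
      {φ | φ e = true} := by
    ext φ
    simp only [Set.mem_image, Set.mem_inter_iff, Set.mem_iInter, Set.mem_ofPred_eq]
    constructor
    · rintro ⟨θ, hθ, rfl⟩
      exact ⟨⟨θ.map_zero, θ.map_mul⟩, hθ⟩
    · rintro ⟨⟨h0, hm⟩, he⟩
      exact ⟨⟨φ, h0, hm, e, he⟩, he, rfl⟩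
  rw [this]
  refine IsClosed.isCompact (IsClosed.inter (IsClosed.inter ?_ ?_) ?_)
  · exact isClosed_eq (continuous_apply _) continuous_const
  · refine isClosed_iInter fun f => isClosed_iInter fun g => isClosed_eq (continuous_apply _) ?_
    have h : Continuous fun p : Bool × Bool => (p.1 && p.2) := continuous_of_discreteTopology
    exact h.comp (f := fun φ : Idem S → Bool => (φ f, φ g))
      ((continuous_apply f).prodMk (continuous_apply g))
  · exact isClosed_eq (continuous_apply _) continuous_const

/-- The compact open set of characters with `θ(e) = 1` and `θ(f) = 0` for all `f ∈ F`. -/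
def basicSet (e : Idem S) (F : Finset (Idem S)) : Set (Character S) :=
  {θ | θ.toFun e = true ∧ ∀ f ∈ F, θ.toFun f = false}

theorem isClosed_basicSet (e : Idem S) (F : Finset (Idem S)) : IsClosed (basicSet e F) := by
  have : basicSet e F = support e ∩ ⋂ f ∈ F, (support f)ᶜ := by
    ext θ
    simp [basicSet, support]
  rw [this]
  exact (isClopen_support e).1.inter
    (isClosed_biInter fun f _ => (isClopen_support f).compl.1)

theorem isOpen_basicSet (e : Idem S) (F : Finset (Idem S)) : IsOpen (basicSet e F) := by
  have : basicSet e F = support e ∩ ⋂ f ∈ F, (support f)ᶜ := by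
    ext θ
    simp [basicSet, support]
  rw [this]
  exact (isClopen_support e).2.inter
    (isOpen_biInter_finset fun f _ => (isClopen_support f).compl.2)

theorem isCompact_basicSet (e : Idem S) (F : Finset (Idem S)) : IsCompact (basicSet e F) :=
  (isCompact_support e).of_isClosed_subset (isClosed_basicSet e F) fun _ h => h.1

/-- A product of idempotents is 1 under a character exactly when every factor is, so finitely many
positive conditions merge into one; only the negative ones need a finite set. -/
theorem exists_basicSet {U : Set (Character S)} (hU : IsOpen U) {θ : Character S} (hθ : θ ∈ U) :
    ∃ e F, θ ∈ basicSet e F ∧ basicSet e F ⊆ U := by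
  classical
  obtain ⟨V, hV, rfl⟩ := isInducing_toFun.isOpen_iff.1 hU
  obtain ⟨I, u, hu, hI⟩ := isOpen_pi_iff.1 hV _ hθ
  have key : ∀ J : Finset (Idem S), (∀ i ∈ J, θ.toFun i = true) → ∃ e, θ.toFun e = true ∧
      ∀ η : Character S, η.toFun e = true → ∀ i ∈ J, η.toFun i = true := by
    intro J
    induction J using Finset.induction_on with
    | empty => exact fun _ => ⟨_, θ.nonzero.choose_spec, by simp⟩
    | insert a J _ ih =>
      intro h
      obtain ⟨e, he, hη⟩ := ih fun i hi => h i (Finset.mem_insert_of_mem hi)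
      refine ⟨a * e, by rw [θ.map_mul, h a (Finset.mem_insert_self _ _), he]; rfl, ?_⟩
      intro η h' i hi
      rw [η.map_mul, Bool.and_eq_true] at h'
      rcases Finset.mem_insert.1 hi with rfl | hi
      · exact h'.1
      · exact hη η h'.2 i hi
  obtain ⟨e, he, hη⟩ := key (I.filter fun i => θ.toFun i = true)
    fun i hi => (Finset.mem_filter.1 hi).2
  refine ⟨e, I.filter fun i => θ.toFun i = false, ⟨he, fun i hi => (Finset.mem_filter.1 hi).2⟩, ?_⟩
  rintro η ⟨h1, h2⟩
  refine hI fun i hi => ?_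
  have : η.toFun i = θ.toFun i := by
    cases h : θ.toFun i with
    | true => exact hη η h1 i (Finset.mem_filter.2 ⟨hi, h⟩)
    | false => exact h2 i (Finset.mem_filter.2 ⟨hi, h⟩)
  rw [this]
  exact (hu i hi).2

instance : T2Space (Character S) :=
  T2Space.of_injective_continuous toFun_injective isInducing_toFun.continuous

instance : WeaklyLocallyCompactSpace (Character S) :=
  ⟨fun θ => by
    obtain ⟨e, he⟩ := θ.nonzero
    exact ⟨support e, isCompact_support e, (isClopen_support e).2.mem_nhds he⟩⟩

/-- Acting by s and then by s* amounts to multiplying by s*s, on which θ is 1. This recovers θ from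
its image, which makes the action injective. -/
theorem act_star_act (θ : Character S) (s : S) (h : θ.toFun (src s) = true) (e : Idem S) :
    (θ.act s h).toFun (conj (star s) e) = θ.toFun e := by
  change θ.toFun (conj s (conj (star s) e)) = θ.toFun e
  rw [← conj_mul_left]
  change θ.toFun (conj (src s).1 e) = θ.toFun e
  rw [conj_idem, θ.map_mul, h, Bool.true_and]

theorem act_injective {θ η : Character S} {s : S} {h : θ.toFun (src s) = true}
    {h' : η.toFun (src s) = true} (he : θ.act s h = η.act s h') : θ = η := by
  ext e
  rw [← act_star_act θ s h, ← act_star_act η s h', he]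

theorem continuous_act (s : S) :
    Continuous fun θ : support (src s) => (θ : Character S).act s θ.2 := by
  refine isInducing_toFun.continuous_iff.2 (continuous_pi fun e => ?_)
  exact (continuous_eval (conj s e)).comp continuous_subtype_val

end Character

/-! ### Germs: neighbourhoods, continuity of the structure maps, ampleness. -/

open Character

theorem germ_mem_germSet {s t : S} {U : Set (Character S)} {θ : Character S}
    {h : θ.toFun (src t) = true} :
    germ t θ h ∈ germSet s U ↔
      θ ∈ U ∧ θ.toFun (src s) = true ∧ ∃ e : Idem S, θ.toFun e = true ∧ t * e.1 = s * e.1 := by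
  constructor
  · rintro ⟨η, h', hη, h3⟩
    obtain ⟨rfl, he⟩ := germ_eq_iff.1 h3
    exact ⟨hη, h', he⟩
  · rintro ⟨h1, h2, h3⟩
    exact ⟨θ, h2, h1, germ_eq_iff.2 ⟨rfl, h3⟩⟩

theorem germ_mem_germSet_self {s : S} {U : Set (Character S)} {θ : Character S}
    {h : θ.toFun (src s) = true} (hθ : θ ∈ U) : germ s θ h ∈ germSet s U := ⟨θ, h, hθ, rfl⟩

theorem germSet_inter_support (s : S) (U : Set (Character S)) :
    germSet s (U ∩ support (src s)) = germSet s U := by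
  ext a
  constructor
  · rintro ⟨θ, h, hθ, rfl⟩
    exact ⟨θ, h, hθ.1, rfl⟩
  · rintro ⟨θ, h, hθ, rfl⟩
    exact ⟨θ, h, ⟨hθ, h⟩, rfl⟩

theorem isOpen_germSet (s : S) {U : Set (Character S)} (hU : IsOpen U) : IsOpen (germSet s U) := by
  rw [← germSet_inter_support]
  exact TopologicalSpace.isOpen_generateFrom_of_mem
    ⟨s, _, hU.inter (isClopen_support _).2, Set.inter_subset_right, rfl⟩

/-- Two representatives of a germ agree after multiplication by an idempotent e with θ(e) = 1, hence
define the same germs on all of D(e). So the neighbourhoods of a germ can be described with any one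
representative fixed. -/
theorem exists_germSet_subset {W : Set (UniversalGroupoid S)} (hW : IsOpen W) {s : S}
    {θ : Character S} {h : θ.toFun (src s) = true} (hθ : germ s θ h ∈ W) :
    ∃ V : Set (Character S), IsOpen V ∧ θ ∈ V ∧ germSet s V ⊆ W := by
  induction hW with
  | basic W hW =>
    obtain ⟨t, U, hU, hUt, rfl⟩ := hW
    obtain ⟨h1, h2, e, he, hse⟩ := germ_mem_germSet.1 hθ
    refine ⟨U ∩ support e, hU.inter (isClopen_support e).2, ⟨h1, he⟩, ?_⟩
    rintro _ ⟨η, hη, hη', rfl⟩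
    exact germ_mem_germSet.2 ⟨hη'.1, hUt hη'.1, e, hη'.2, hse⟩
  | univ => exact ⟨Set.univ, isOpen_univ, trivial, Set.subset_univ _⟩
  | inter W W' _ _ ih ih' =>
    obtain ⟨V, h1, h2, h3⟩ := ih hθ.1
    obtain ⟨V', h1', h2', h3'⟩ := ih' hθ.2
    refine ⟨V ∩ V', h1.inter h1', ⟨h2, h2'⟩, ?_⟩
    rintro _ ⟨η, hη, hη', rfl⟩
    exact ⟨h3 (germ_mem_germSet_self hη'.1), h3' (germ_mem_germSet_self hη'.2)⟩
  | sUnion 𝒲 _ ih =>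
    obtain ⟨W, hW, hθ⟩ := hθ
    obtain ⟨V, h1, h2, h3⟩ := ih W hW hθ
    exact ⟨V, h1, h2, h3.trans (Set.subset_sUnion_of_mem hW)⟩

theorem exists_germSet_basicSet_subset {W : Set (UniversalGroupoid S)} (hW : IsOpen W) {s : S}
    {θ : Character S} {h : θ.toFun (src s) = true} (hθ : germ s θ h ∈ W) :
    ∃ e F, θ ∈ basicSet e F ∧ basicSet e F ⊆ support (src s) ∧ germSet s (basicSet e F) ⊆ W := by
  obtain ⟨V, h1, h2, h3⟩ := exists_germSet_subset hW hθ
  obtain ⟨e, F, h4, h5⟩ := exists_basicSet (h1.inter (isClopen_support (src s)).2) ⟨h2, h⟩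
  refine ⟨e, F, h4, h5.trans Set.inter_subset_right, ?_⟩
  rintro _ ⟨η, hη, hη', rfl⟩
  exact h3 (germ_mem_germSet_self (h5 hη').1)

theorem germ_mem_nhds {W : Set (UniversalGroupoid S)} {s : S} {θ : Character S}
    {h : θ.toFun (src s) = true} :
    W ∈ 𝓝 (germ s θ h) ↔ ∃ V : Set (Character S), IsOpen V ∧ θ ∈ V ∧ germSet s V ⊆ W := by
  rw [mem_nhds_iff]
  constructor
  · rintro ⟨O, hO, ho, hθ⟩
    obtain ⟨V, h1, h2, h3⟩ := exists_germSet_subset ho hθ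
    exact ⟨V, h1, h2, h3.trans hO⟩
  · rintro ⟨V, h1, h2, h3⟩
    exact ⟨_, h3, isOpen_germSet s h1, germ_mem_germSet_self h2⟩

theorem continuous_germ (s : S) :
    Continuous fun θ : support (src s) => germ s (θ : Character S) θ.2 := by
  rw [continuous_iff_continuousAt]
  intro θ W hW
  obtain ⟨V, h1, h2, h3⟩ := germ_mem_nhds.1 hW
  exact Filter.mem_map.2 (Filter.mem_of_superset
    ((h1.preimage continuous_subtype_val).mem_nhds h2)
    fun η hη => h3 (germ_mem_germSet_self (h := η.2) hη))

theorem continuous_source : Continuous (UniversalGroupoid.source : UniversalGroupoid S → _) := by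
  rw [continuous_iff_continuousAt]
  intro a W hW
  obtain ⟨s, θ, h, rfl⟩ := germ_surj a
  obtain ⟨V, hV, hVo, hθ⟩ := mem_nhds_iff.1 hW
  refine germ_mem_nhds.2 ⟨V, hVo, hθ, ?_⟩
  rintro _ ⟨η, hη, hη', rfl⟩
  exact hV hη'

theorem continuous_unitGerm : Continuous (unitGerm : Character S → UniversalGroupoid S) := by
  rw [continuous_iff_continuousAt]
  intro θ W hW
  obtain ⟨e, he⟩ := θ.nonzero
  have he' : θ.toFun (src e.1) = true := by rwa [src_idem]
  rw [← unitGerm_eq θ e he'] at hW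
  obtain ⟨V, h1, h2, h3⟩ := germ_mem_nhds.1 hW
  refine Filter.mem_map.2 (Filter.mem_of_superset
    ((h1.inter (isClopen_support (src e.1)).2).mem_nhds ⟨h2, he'⟩) ?_)
  rintro η ⟨hη, hη'⟩
  change unitGerm η ∈ W
  rw [← unitGerm_eq η e hη']
  exact h3 (germ_mem_germSet_self hη)

theorem isOpenMap_source : IsOpenMap (UniversalGroupoid.source : UniversalGroupoid S → _) := by
  rw [isOpenMap_iff_nhds_le]
  intro a W hW
  obtain ⟨s, θ, h, rfl⟩ := germ_surj a
  obtain ⟨V, h1, h2, h3⟩ := germ_mem_nhds.1 hW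
  refine Filter.mem_of_superset ((h1.inter (isClopen_support (src s)).2).mem_nhds ⟨h2, h⟩) ?_
  rintro η ⟨hη, hη'⟩
  exact h3 (germ_mem_germSet_self (h := hη') hη)

theorem injOn_source_germSet (s : S) (U : Set (Character S)) :
    Set.InjOn UniversalGroupoid.source (germSet s U) := by
  rintro _ ⟨θ, h, -, rfl⟩ _ ⟨η, h', -, rfl⟩ (he : θ = η)
  subst he
  rfl

theorem injOn_target_germSet (s : S) (U : Set (Character S)) :
    Set.InjOn UniversalGroupoid.target (germSet s U) := by
  rintro _ ⟨θ, h, -, rfl⟩ _ ⟨η, h', -, rfl⟩ (he : θ.act s h = η.act s h')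
  obtain rfl := act_injective he
  rfl

/-- On the set of all germs of a fixed s a germ is determined by its source, and the source map is
continuous and open. -/
theorem isLocalHomeomorph_source :
    IsLocalHomeomorph (UniversalGroupoid.source : UniversalGroupoid S → _) := by
  rw [isLocalHomeomorph_iff_isOpenEmbedding_restrict]
  intro a
  obtain ⟨s, θ, h, rfl⟩ := germ_surj a
  have ho : IsOpen (germSet s (Set.univ : Set (Character S))) := isOpen_germSet s isOpen_univ
  exact ⟨_, ho.mem_nhds (germ_mem_germSet_self trivial), .of_continuous_injective_isOpenMap
    (continuous_source.comp continuous_subtype_val)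
    (Set.injOn_iff_injective.1 (injOn_source_germSet s _)) (isOpenMap_source.domRestrict ho)⟩

theorem unitGerm_mem_unitSpace (θ : Character S) :
    unitGerm θ ∈ unitSpace (UniversalGroupoid S) := ⟨unitGerm θ, rfl⟩

variable (S) in
/-- The unit space of the universal groupoid is the spectrum. -/
noncomputable def unitSpaceHomeomorph : Character S ≃ₜ unitSpace (UniversalGroupoid S) where
  toFun θ := ⟨unitGerm θ, unitGerm_mem_unitSpace θ⟩
  invFun a := a.1.source
  left_inv _ := rfl
  right_inv := by
    rintro ⟨_, a, rfl⟩
    rfl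
  continuous_toFun := continuous_unitGerm.subtype_mk _
  continuous_invFun := continuous_source.comp continuous_subtype_val

theorem continuous_inv_universalGroupoid :
    Continuous (ArrowGroupoid.inv : UniversalGroupoid S → UniversalGroupoid S) := by
  rw [continuous_iff_continuousAt]
  intro a W hW
  obtain ⟨s, θ, h, rfl⟩ := germ_surj a
  obtain ⟨V, h1, h2, h3⟩ := germ_mem_nhds.1
    (show W ∈ 𝓝 (germ (star s) (θ.act s h) (mem_star h)) from hW)
  -- The action of s is defined only on D(s*s), so the preimage of V is relatively open; V' is an
  -- open set of characters inducing it.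
  obtain ⟨V', hV', h4⟩ := isOpen_induced_iff.1 (h1.preimage (continuous_act s))
  have h5 : ∀ η (hη : η.toFun (src s) = true), η ∈ V' ↔ η.act s hη ∈ V := fun η hη => by
    exact Set.ext_iff.1 h4 ⟨η, hη⟩
  refine germ_mem_nhds.2 ⟨V', hV', (h5 θ h).2 h2, ?_⟩
  rintro _ ⟨η, hη, hη', rfl⟩
  exact h3 (germ_mem_germSet_self (h := mem_star hη) ((h5 η hη).1 hη'))

theorem continuousOn_comp_universalGroupoid :
    ContinuousOn (fun p : UniversalGroupoid S × UniversalGroupoid S => comp p.1 p.2)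
      {p | (dom p.1 : UniversalGroupoid S) = ran p.2} := by
  rintro ⟨a, b⟩ hab W hW
  obtain ⟨s, η, hs, rfl⟩ := germ_surj a
  obtain ⟨t, θ, ht, rfl⟩ := germ_surj b
  have hη : η = θ.act t ht := unitGerm_inj.1 hab
  have h0 : comp (germ s η hs) (germ t θ ht) = germ (s * t) θ (mem_mul ht (hη ▸ hs)) :=
    UniversalGroupoid.comp_germ hη
  change W ∈ 𝓝 (comp (germ s η hs) (germ t θ ht)) at hW
  rw [h0] at hW
  obtain ⟨V, h1, h2, h3⟩ := germ_mem_nhds.1 hW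
  -- The product germ has the source of its right factor, so only that factor has to be restricted.
  refine mem_nhdsWithin.2 ⟨germSet s Set.univ ×ˢ germSet t V,
    (isOpen_germSet s isOpen_univ).prod (isOpen_germSet t h1),
    ⟨germ_mem_germSet_self trivial, germ_mem_germSet_self h2⟩, ?_⟩
  rintro ⟨_, _⟩ ⟨⟨⟨η', hη', -, rfl⟩, ⟨θ', hθ', hV, rfl⟩⟩, hab'⟩
  have hη'' : η' = θ'.act t hθ' := unitGerm_inj.1 hab'
  have h0 : comp (germ s η' hη') (germ t θ' hθ') = germ (s * t) θ' (mem_mul hθ' (hη'' ▸ hη')) :=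
    UniversalGroupoid.comp_germ hη''
  change comp (germ s η' hη') (germ t θ' hθ') ∈ W
  rw [h0]
  exact h3 (germ_mem_germSet_self hV)

instance : IsAmpleGroupoid (UniversalGroupoid S) where
  continuous_dom := continuous_unitGerm.comp continuous_source
  continuous_ran := by
    have : (ran : UniversalGroupoid S → UniversalGroupoid S) = dom ∘ ArrowGroupoid.inv :=
      funext fun a => (dom_inv a).symm
    rw [this]
    exact (continuous_unitGerm.comp continuous_source).comp continuous_inv_universalGroupoid
  continuous_inv := continuous_inv_universalGroupoid
  continuousOn_comp := continuousOn_comp_universalGroupoid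
  isLocalHomeomorph_dom :=
    (unitSpaceHomeomorph S).isLocalHomeomorph.comp isLocalHomeomorph_source
  t2Space_units := (unitSpaceHomeomorph S).t2Space
  locallyCompactSpace_units :=
    (unitSpaceHomeomorph S).symm.isClosedEmbedding.locallyCompactSpace
  basis_units := by
    refine TopologicalSpace.isTopologicalBasis_of_isOpen_of_nhds (fun U h => h.1) ?_
    intro a U ha hU
    let φ := unitSpaceHomeomorph S
    have ha' : φ.symm a ∈ φ ⁻¹' U := by rwa [Set.mem_preimage, φ.apply_symm_apply]
    obtain ⟨e, F, h1, h2⟩ := exists_basicSet (hU.preimage φ.continuous) ha'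
    exact ⟨φ '' basicSet e F, ⟨φ.isOpenMap _ (isOpen_basicSet e F),
      (isCompact_basicSet e F).image φ.continuous⟩, ⟨_, h1, φ.apply_symm_apply a⟩,
      Set.image_subset_iff.2 h2⟩

theorem secondCountableTopology_universalGroupoid [Countable S] :
    SecondCountableTopology (UniversalGroupoid S) := by
  let f : S × Idem S × Finset (Idem S) → Set (UniversalGroupoid S) :=
    fun p => germSet p.1 (basicSet p.2.1 p.2.2)
  have hf : TopologicalSpace.IsTopologicalBasis (Set.range f) := by
    refine TopologicalSpace.isTopologicalBasis_of_isOpen_of_nhds ?_ ?_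
    · rintro _ ⟨p, rfl⟩
      exact isOpen_germSet _ (isOpen_basicSet _ _)
    · intro a W ha hW
      obtain ⟨s, θ, h, rfl⟩ := germ_surj a
      obtain ⟨e, F, h1, -, h2⟩ := exists_germSet_basicSet_subset hW ha
      exact ⟨_, ⟨(s, e, F), rfl⟩, germ_mem_germSet_self h1, h2⟩
  exact hf.secondCountableTopology (Set.countable_range f)

end UniversalGroupoidTopology

/-! ### The contracted semigroup algebra inside the Steinberg algebra. -/

section SteinbergContracted

variable {S : Type*} [InverseSemigroupWithZero S]

instance : CommSemigroup (Idem S) where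
  mul_assoc e f g := Subtype.ext (mul_assoc e.1 f.1 g.1)
  mul_comm e f := Subtype.ext (idem_comm e.2 f.2)

theorem idem_mul_self (e : Idem S) : e * e = e := Subtype.ext e.2

open Classical in
/-- The principal character of an idempotent `e ≠ 0`: it is `1` exactly on the idempotents
above `e`. -/
noncomputable def Character.principal (e : Idem S) (he : e ≠ 0) : Character S where
  toFun f := decide (e * f = e)
  map_zero := by
    have : e * 0 = 0 := Subtype.ext (mul_zero e.1)
    rw [this, decide_eq_false_iff_not]
    exact he.symm
  map_mul f g := by
    rw [← Bool.decide_and, decide_eq_decide]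
    constructor
    · intro h
      constructor
      · rw [← h, mul_assoc, mul_comm _ f, ← mul_assoc f f g, idem_mul_self f]
      · rw [← h, mul_assoc, mul_assoc f, idem_mul_self g]
    · rintro ⟨h, h'⟩
      rw [← mul_assoc, h, h']
  nonzero := ⟨e, decide_eq_true (idem_mul_self e)⟩

theorem Character.principal_apply {e : Idem S} (he : e ≠ 0) (f : Idem S) :
    (principal e he).toFun f = true ↔ e * f = e := by
  simp [principal]

open Character

theorem isCompact_germSet_univ (s : S) : IsCompact (germSet s Set.univ) := by
  have : CompactSpace (support (src s)) := isCompact_iff_compactSpace.1 (isCompact_support _)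
  have h := isCompact_range (continuous_germ s)
  convert h using 1
  ext a
  constructor
  · rintro ⟨θ, h, -, rfl⟩
    exact ⟨⟨θ, h⟩, rfl⟩
  · rintro ⟨θ, rfl⟩
    exact ⟨θ, θ.2, trivial, rfl⟩

theorem isCompactBisection_germSet_univ (s : S) :
    IsCompactBisection (germSet s (Set.univ : Set (Character S))) where
  isOpen := isOpen_germSet s isOpen_univ
  isCompact := isCompact_germSet_univ s
  isEmbedding_dom := isEmbedding_restrict IsAmpleGroupoid.isLocalHomeomorph_dom
    (isOpen_germSet s isOpen_univ) fun _ ha _ hb h =>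
      injOn_source_germSet s _ ha hb (unitGerm_inj.1 (congrArg Subtype.val h))
  isEmbedding_ran := isEmbedding_restrict isLocalHomeomorph_ran
    (isOpen_germSet s isOpen_univ) fun _ ha _ hb h =>
      injOn_target_germSet s _ ha hb (unitGerm_inj.1 (congrArg Subtype.val h))

theorem src_mul_mul_src (s t : S) : src (s * t) * src t = src (s * t) := by
  refine Subtype.ext ?_
  change star (s * t) * (s * t) * (star t * t) = star (s * t) * (s * t)
  rw [mul_assoc, mul_assoc s, ← mul_assoc t, mul_star_mul_self]

theorem setComp_germSet_univ (s t : S) :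
    setComp (germSet s (Set.univ : Set (Character S))) (germSet t Set.univ) =
      germSet (s * t) Set.univ := by
  ext c
  constructor
  · rintro ⟨_, ⟨η, hη, -, rfl⟩, _, ⟨θ, hθ, -, rfl⟩, h, rfl⟩
    have h' : η = θ.act t hθ := unitGerm_inj.1 h
    exact ⟨θ, mem_mul hθ (h' ▸ hη), trivial, UniversalGroupoid.comp_germ h'⟩
  · rintro ⟨θ, hθ, -, rfl⟩
    have ht : θ.toFun (src t) = true := by
      have h := hθ
      rw [← src_mul_mul_src, θ.map_mul, Bool.and_eq_true] at h
      exact h.2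
    have hs : (θ.act t ht).toFun (src s) = true := by
      change θ.toFun (conj t (src s)) = true
      rwa [conj_src]
    exact ⟨germ s _ hs, ⟨_, hs, trivial, rfl⟩, germ t θ ht, ⟨_, ht, trivial, rfl⟩, rfl,
      UniversalGroupoid.comp_germ rfl⟩

theorem germSet_zero (U : Set (Character S)) : germSet (0 : S) U = ∅ := by
  refine Set.eq_empty_of_forall_notMem ?_
  rintro _ ⟨θ, h, -, rfl⟩
  have : src (0 : S) = 0 := Subtype.ext (mul_zero _)
  rw [this, θ.map_zero] at h
  exact Bool.false_ne_true h

theorem src_ne_zero {s : S} (hs : s ≠ 0) : src s ≠ 0 := by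
  intro h
  apply hs
  have h' : star s * s = 0 := congrArg Subtype.val h
  rw [← mul_star_mul_self s, mul_assoc, h', mul_zero]

theorem principal_src {s : S} (hs : s ≠ 0) :
    (principal (src s) (src_ne_zero hs)).toFun (src s) = true :=
  (principal_apply _ _).2 (idem_mul_self (src s))

/-- The germ of `s ≠ 0` at the principal character of `s^* s`. -/
noncomputable def principalGerm (s : S) (hs : s ≠ 0) : UniversalGroupoid S :=
  germ s (principal (src s) (src_ne_zero hs)) (principal_src hs)

/-- The idempotents that are 1 under the principal character of s*s are those above s*s, so equality
of germs there already holds after multiplication by s*s. The conclusion is s ≤ t in the natural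
order, and this germ therefore separates s from every element not above it. -/
theorem eq_mul_src_of_principalGerm_mem {s t : S} {hs : s ≠ 0} {U : Set (Character S)}
    (h : principalGerm s hs ∈ germSet t U) : s = t * (src s).1 := by
  obtain ⟨-, -, e, he, hst⟩ := germ_mem_germSet.1 h
  rw [principal_apply, mul_comm] at he
  have h1 : e.1 * (src s).1 = (src s).1 := congrArg Subtype.val he
  calc s = s * (src s).1 := by
        change s = s * (star s * s)
        rw [← mul_assoc, mul_star_mul_self]
    _ = t * (src s).1 := by rw [← h1, ← mul_assoc, hst, mul_assoc]

theorem germSet_univ_subset {s t : S} (h : s = t * (src s).1) :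
    germSet s (Set.univ : Set (Character S)) ⊆ germSet t Set.univ := by
  rintro _ ⟨θ, hθ, -, rfl⟩
  refine germ_mem_germSet.2 ⟨trivial, ?_, src s, hθ, ?_⟩
  · have h1 : src s = conj (src s).1 (src t) := by rw [conj_src, ← h]
    rw [h1, conj_idem, θ.map_mul, Bool.and_eq_true] at hθ
    exact hθ.2
  · rw [← h]
    change s * (star s * s) = s
    rw [← mul_assoc, mul_star_mul_self]

/-- Antisymmetry of the natural partial order. -/
theorem eq_of_eq_mul_src {s t : S} (h : s = t * (src s).1) (h' : t = s * (src t).1) : s = t := by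
  have h1 : s * (src s).1 = s := by
    change s * (star s * s) = s
    rw [← mul_assoc, mul_star_mul_self]
  calc s = s * (src t).1 * (src s).1 := by rw [← h', ← h]
    _ = s * (src s).1 * (src t).1 := by
      rw [mul_assoc, idem_comm (src t).2 (src s).2, mul_assoc]
    _ = t := by rw [h1, ← h']

/-- Right multiplication by e is restriction of the source to D(e). This keeps the span of the germ
sets closed under restriction, and lets germs of different elements be compared over a cylinder. -/
theorem germSet_inter_source_support (s : S) (e : Idem S) :
    germSet s Set.univ ∩ UniversalGroupoid.source ⁻¹' support e =
      germSet (s * e.1) (Set.univ : Set (Character S)) := by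
  have hsrc : ∀ θ : Character S,
      θ.toFun (src (s * e.1)) = (θ.toFun e && θ.toFun (src s)) := fun θ => by
    rw [← conj_src, conj_idem, θ.map_mul]
  ext a
  constructor
  · rintro ⟨⟨θ, hθ, -, rfl⟩, he⟩
    have he : θ.toFun e = true := he
    refine germ_mem_germSet.2 ⟨trivial, by rw [hsrc, he, hθ]; rfl, e, he, ?_⟩
    rw [mul_assoc, e.2]
  · rintro ⟨θ, hθ, -, rfl⟩
    have h := hθ
    rw [hsrc, Bool.and_eq_true] at h
    exact ⟨germ_mem_germSet.2 ⟨trivial, h.2, e, h.1, by rw [mul_assoc, e.2]⟩, h.1⟩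

variable (K : Type*) [CommRing K]

/-- The characteristic function of the set of all germs of `s`. -/
noncomputable def germChar (s : S) : SteinbergAlgebra (UniversalGroupoid S) K :=
  ⟨charFun K (germSet s Set.univ), charFun_mem (isCompactBisection_germSet_univ s)⟩

theorem germChar_mul (s t : S) : germChar K s * germChar K t = germChar K (s * t) := by
  refine Subtype.ext ?_
  change conv (charFun K _) (charFun K _) = charFun K _
  rw [charFun_conv (isCompactBisection_germSet_univ s), setComp_germSet_univ]

theorem germChar_zero : germChar K (0 : S) = 0 := by
  refine Subtype.ext ?_
  change charFun K (germSet (0 : S) Set.univ) = 0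
  rw [germSet_zero]
  exact Set.indicator_empty _

variable (S) in
/-- The linear extension of `s ↦ germChar K s` to the free module on `S ∖ {0}`. -/
noncomputable def germLinear :
    ({s : S // s ≠ 0} →₀ K) →ₗ[K] SteinbergAlgebra (UniversalGroupoid S) K :=
  Finsupp.linearCombination K fun s => germChar K s.1

theorem germLinear_basisElt (s : S) :
    germLinear S K (ContractedAlgebra.basisElt K s) = germChar K s := by
  by_cases hs : s = 0
  · rw [hs, ContractedAlgebra.basisElt_zero, _root_.map_zero, germChar_zero]
  · have h1 : ContractedAlgebra.basisElt K s = Finsupp.single ⟨s, hs⟩ 1 := dif_neg hs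
    rw [h1, germLinear, Finsupp.linearCombination_single, one_smul]

theorem germLinear_mulFun (a b : {s : S // s ≠ 0} →₀ K) :
    germLinear S K (ContractedAlgebra.mulFun a b) = germLinear S K a * germLinear S K b := by
  induction a using ContractedAlgebra.basis_induction with
  | h0 => rw [ContractedAlgebra.zero_mulFun, _root_.map_zero, zero_mul]
  | ha a a' h h' => rw [ContractedAlgebra.add_mulFun, map_add, map_add, h, h', add_mul]
  | hs k s =>
    induction b using ContractedAlgebra.basis_induction with
    | h0 => rw [ContractedAlgebra.mulFun_zero, _root_.map_zero, mul_zero]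
    | ha a a' h h' => rw [ContractedAlgebra.mulFun_add, map_add, map_add, h, h', mul_add]
    | hs l t =>
      rw [ContractedAlgebra.smul_mulFun, ContractedAlgebra.mulFun_smul,
        ContractedAlgebra.mulFun_basisElt]
      simp only [map_smul, germLinear_basisElt, smul_mul_assoc, mul_smul_comm, germChar_mul]
      rw [smul_comm]

variable (S) in
/-- The homomorphism from the contracted semigroup algebra to the Steinberg algebra of the
universal groupoid. -/
noncomputable def germHom :
    ContractedAlgebra K S →ₙₐ[K] SteinbergAlgebra (UniversalGroupoid S) K where
  toFun := germLinear S K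
  map_smul' k a := (germLinear S K).map_smul k a
  map_zero' := (germLinear S K).map_zero
  map_add' := (germLinear S K).map_add
  map_mul' := germLinear_mulFun K

theorem germLinear_apply (a : {s : S // s ≠ 0} →₀ K) (γ : UniversalGroupoid S) :
    (germLinear S K a).1 γ = ∑ s ∈ a.support, a s * charFun K (germSet s.1 Set.univ) γ := by
  have h : (germLinear S K a).1 = ∑ s ∈ a.support, a s • charFun K (germSet s.1 Set.univ) := by
    change (steinbergSubmodule (UniversalGroupoid S) K).subtype
      (∑ s ∈ a.support, a s • germChar K s.1) = _
    exact map_sum (steinbergSubmodule (UniversalGroupoid S) K).subtype _ _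
  rw [h, Finset.sum_apply]
  rfl

theorem germLinear_injective : Function.Injective (germLinear S K) := by
  classical
  rw [← LinearMap.ker_eq_bot, LinearMap.ker_eq_bot']
  intro a ha
  by_contra hne
  -- Take s in the support with maximal germ set and evaluate at its principal germ. A further
  -- contribution could only come from some t above s; maximality then puts t below s as well, so t
  -- = s and the coefficient of s must vanish.
  obtain ⟨s, hs, hmax⟩ := Finset.exists_maximalFor
    (fun s : {s : S // s ≠ 0} => germSet s.1 (Set.univ : Set (Character S))) a.support
    (Finsupp.support_nonempty_iff.2 hne)
  have h0 : (germLinear S K a).1 (principalGerm s.1 s.2) = 0 := by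
    rw [ha]
    rfl
  rw [germLinear_apply, Finset.sum_eq_single s] at h0
  · have : principalGerm s.1 s.2 ∈ germSet s.1 (Set.univ : Set (Character S)) :=
      germ_mem_germSet_self trivial
    rw [charFun, Set.indicator_of_mem this, Pi.one_apply, mul_one] at h0
    exact Finsupp.mem_support_iff.1 hs h0
  · intro t ht hts
    rw [charFun, Set.indicator_of_notMem, mul_zero]
    intro hmem
    have h1 := eq_mul_src_of_principalGerm_mem hmem
    have h2 := hmax ht (germSet_univ_subset h1)
    have h3 := eq_mul_src_of_principalGerm_mem
      (h2 (show principalGerm t.1 t.2 ∈ germSet t.1 Set.univ from germ_mem_germSet_self trivial))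
    exact hts (Subtype.ext (eq_of_eq_mul_src h1 h3).symm)
  · exact fun h => (h hs).elim

/-! ### Every compact local bisection lies in the span of the germ sets. -/

variable (S) in
/-- The span of the characteristic functions of the sets of germs of the elements of `S`. -/
noncomputable def germSpan : Submodule K (UniversalGroupoid S → K) :=
  Submodule.span K (Set.range fun s : S => charFun K (germSet s Set.univ))

variable (S) in
/-- Sets of characters such that the restriction to the germs with source in it preserves
`germSpan`. -/
def IsGermSpanStable (W : Set (Character S)) : Prop :=
  ∀ f ∈ germSpan S K, (UniversalGroupoid.source ⁻¹' W).indicator f ∈ germSpan S K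

variable {K}

theorem IsGermSpanStable.compl {W : Set (Character S)} (h : IsGermSpanStable S K W) :
    IsGermSpanStable S K Wᶜ := by
  intro f hf
  rw [Set.preimage_compl, Set.indicator_compl]
  exact Submodule.sub_mem _ hf (h f hf)

theorem IsGermSpanStable.inter {W W' : Set (Character S)} (h : IsGermSpanStable S K W)
    (h' : IsGermSpanStable S K W') : IsGermSpanStable S K (W ∩ W') := by
  intro f hf
  rw [Set.preimage_inter, ← Set.indicator_indicator]
  exact h _ (h' f hf)

theorem isGermSpanStable_univ : IsGermSpanStable S K Set.univ := by
  intro f hf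
  rwa [Set.preimage_univ, Set.indicator_univ]

theorem isGermSpanStable_support (e : Idem S) : IsGermSpanStable S K (support e) := by
  intro f hf
  refine Submodule.span_induction
    (p := fun f _ => (UniversalGroupoid.source ⁻¹' support e).indicator f ∈ germSpan S K)
    ?_ ?_ ?_ ?_ hf
  · rintro _ ⟨s, rfl⟩
    simp only [charFun]
    rw [Set.indicator_indicator, Set.inter_comm, germSet_inter_source_support]
    exact Submodule.subset_span ⟨s * e.1, rfl⟩
  · rw [Set.indicator_zero']
    exact Submodule.zero_mem _
  · intro f g _ _ hf hg
    rw [Set.indicator_add']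
    exact Submodule.add_mem _ hf hg
  · intro k f _ hf
    have : (UniversalGroupoid.source ⁻¹' support e).indicator (k • f) =
        k • (UniversalGroupoid.source ⁻¹' support e).indicator f := Set.indicator_const_smul _ k f
    rw [this]
    exact Submodule.smul_mem _ k hf

theorem isGermSpanStable_basicSet (e : Idem S) (F : Finset (Idem S)) :
    IsGermSpanStable S K (basicSet e F) := by
  classical
  induction F using Finset.induction_on with
  | empty =>
    have : basicSet e ∅ = support e := by
      ext θ
      simp [basicSet, support]
    rw [this]
    exact isGermSpanStable_support e
  | insert f F _ ih =>
    have : basicSet e (insert f F) = (support f)ᶜ ∩ basicSet e F := by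
      ext θ
      simp only [basicSet, support, Finset.forall_mem_insert, Set.mem_ofPred_eq, Set.mem_inter_iff,
        Set.mem_compl_iff, Bool.not_eq_true]
      tauto
    rw [this]
    exact (isGermSpanStable_support f).compl.inter ih

theorem charFun_inter_preimage {𝒢 : Type*} (U V : Set 𝒢) :
    charFun K (V ∩ U) = V.indicator (charFun K U) := (Set.indicator_indicator _ _ _).symm

/-- Near each of its points U coincides, over a basic set of sources, with all germs of a single
element. Compactness glues finitely many such pieces, since the stable sets of sources are closed
under Boolean operations. -/
theorem charFun_mem_germSpan {U : Set (UniversalGroupoid S)} (hU : IsCompactBisection U) :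
    charFun K U ∈ germSpan S K := by
  have key : ∃ W, IsGermSpanStable S K W ∧ U ⊆ UniversalGroupoid.source ⁻¹' W ∧
      charFun K (UniversalGroupoid.source ⁻¹' W ∩ U) ∈ germSpan S K := by
    refine hU.isCompact.induction_on (p := fun V => ∃ W, IsGermSpanStable S K W ∧
      V ⊆ UniversalGroupoid.source ⁻¹' W ∧
      charFun K (UniversalGroupoid.source ⁻¹' W ∩ U) ∈ germSpan S K) ?_ ?_ ?_ ?_
    · refine ⟨Set.univᶜ, isGermSpanStable_univ.compl, Set.empty_subset _, ?_⟩
      have : UniversalGroupoid.source ⁻¹' (Set.univᶜ : Set (Character S)) ∩ U = ∅ := by simp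
      rw [this, charFun, Set.indicator_empty]
      exact Submodule.zero_mem _
    · rintro V V' hV ⟨W, h1, h2, h3⟩
      exact ⟨W, h1, hV.trans h2, h3⟩
    · rintro V V' ⟨W, h1, h2, h3⟩ ⟨W', h1', h2', h3'⟩
      -- This is W ∪ W', written so that stability follows from complements and intersections. The
      -- part over W' is cut down to the complement of W so that nothing is counted twice.
      refine ⟨(Wᶜ ∩ W'ᶜ)ᶜ, (h1.compl.inter h1'.compl).compl, ?_, ?_⟩
      · rw [← Set.compl_union, compl_compl]
        exact Set.union_subset_union h2 h2'
      · have : charFun K (UniversalGroupoid.source ⁻¹' (Wᶜ ∩ W'ᶜ)ᶜ ∩ U) =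
            charFun K (UniversalGroupoid.source ⁻¹' W ∩ U) +
            (UniversalGroupoid.source ⁻¹' Wᶜ).indicator
              (charFun K (UniversalGroupoid.source ⁻¹' W' ∩ U)) := by
          funext a
          by_cases h : a.source ∈ W <;> by_cases h' : a.source ∈ W' <;> by_cases hU : a ∈ U <;>
            simp [charFun, Set.indicator, h, h', hU]
        rw [this]
        exact Submodule.add_mem _ h3 (h1.compl _ h3')
    · intro a ha
      obtain ⟨s, θ, h, rfl⟩ := germ_surj a
      obtain ⟨e, F, h1, h2, h3⟩ := exists_germSet_basicSet_subset hU.isOpen ha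
      refine ⟨germSet s (basicSet e F), mem_nhdsWithin_of_mem_nhds
        ((isOpen_germSet s (isOpen_basicSet e F)).mem_nhds (germ_mem_germSet_self h1)),
        basicSet e F, isGermSpanStable_basicSet e F, ?_, ?_⟩
      · rintro _ ⟨η, hη, hη', rfl⟩
        exact hη'
      -- U contains the germs of s over the basic set, and at most one germ per source, hence no
      -- others there.
      · have : UniversalGroupoid.source ⁻¹' basicSet e F ∩ U =
            UniversalGroupoid.source ⁻¹' basicSet e F ∩ germSet s Set.univ := by
          ext b
          constructor
          · rintro ⟨hb, hbU⟩
            refine ⟨hb, ?_⟩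
            have hm : germ s b.source (h2 hb) ∈ germSet s (basicSet e F) :=
              germ_mem_germSet_self hb
            rw [hU.injOn_dom hbU (h3 hm) rfl]
            exact germ_mem_germSet_self trivial
          · rintro ⟨hb, η, hη, -, rfl⟩
            exact ⟨hb, h3 (germ_mem_germSet_self hb)⟩
        rw [this, charFun_inter_preimage]
        exact isGermSpanStable_basicSet e F _ (Submodule.subset_span ⟨s, rfl⟩)
  obtain ⟨W, -, h2, h3⟩ := key
  rwa [Set.inter_eq_right.2 h2] at h3

theorem germLinear_surjective : Function.Surjective (germLinear S K) := by
  rintro ⟨f, hf⟩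
  have h : steinbergSubmodule (UniversalGroupoid S) K ≤ germSpan S K :=
    Submodule.span_le.2 (by rintro _ ⟨U, hU, rfl⟩; exact charFun_mem_germSpan hU)
  have h' : germSpan S K ≤ LinearMap.range
      ((steinbergSubmodule (UniversalGroupoid S) K).subtype ∘ₗ germLinear S K) := by
    refine Submodule.span_le.2 ?_
    rintro _ ⟨s, rfl⟩
    exact ⟨ContractedAlgebra.basisElt K s, congrArg Subtype.val (germLinear_basisElt K s)⟩
  obtain ⟨a, ha⟩ := h' (h hf)
  exact ⟨a, Subtype.ext ha⟩

theorem germHom_bijective : Function.Bijective (germHom S K) :=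
  ⟨germLinear_injective K, germLinear_surjective⟩

/-! ### Ideals from invariant sets of characters. -/

variable (K) in
/-- The functions that vanish on all germs with source in a given invariant set of characters. -/
noncomputable def vanishingIdeal (Z : Set (Character S))
    (hZ : ∀ a : UniversalGroupoid S, a.source ∈ Z → a.target ∈ Z) :
    TwoSidedIdeal (SteinbergAlgebra (UniversalGroupoid S) K) :=
  TwoSidedIdeal.mk' {f | ∀ a : UniversalGroupoid S, a.source ∈ Z → f.1 a = 0}
    (fun _ _ => rfl)
    (fun {f g} hf hg a ha => by
      change f.1 a + g.1 a = 0
      rw [hf a ha, hg a ha, add_zero])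
    (fun {f} hf a ha => by
      change -f.1 a = 0
      rw [hf a ha, neg_zero])
    (fun {f g} hg c hc => by
      change conv f.1 g.1 c = 0
      refine (finsum_congr ?_).trans finsum_zero
      rintro ⟨⟨a, b⟩, hab, rfl⟩
      have h1 : (comp a b).source = b.source := unitGerm_inj.1 (dom_comp a b hab)
      rw [hg b (h1 ▸ hc), mul_zero])
    (fun {f g} hf c hc => by
      change conv f.1 g.1 c = 0
      refine (finsum_congr ?_).trans finsum_zero
      rintro ⟨⟨a, b⟩, hab, rfl⟩
      have h1 : (comp a b).source = b.source := unitGerm_inj.1 (dom_comp a b hab)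
      have h2 : a.source = b.target := unitGerm_inj.1 hab
      rw [hf a (h2 ▸ hZ b (h1 ▸ hc)), zero_mul])

theorem mem_vanishingIdeal {Z : Set (Character S)}
    {hZ : ∀ a : UniversalGroupoid S, a.source ∈ Z → a.target ∈ Z}
    {f : SteinbergAlgebra (UniversalGroupoid S) K} :
    f ∈ vanishingIdeal K Z hZ ↔ ∀ a : UniversalGroupoid S, a.source ∈ Z → f.1 a = 0 :=
  TwoSidedIdeal.mem_mk' _ _ _ _ _ _ _

theorem not_isSimpleRing_of_mem_of_notMem {R : Type*} [NonUnitalNonAssocRing R]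
    (I : TwoSidedIdeal R) {x y : R} (hx : x ∈ I) (hx0 : x ≠ 0) (hy : y ∉ I) :
    ¬ IsSimpleRing R := by
  intro h
  rcases eq_bot_or_eq_top I with rfl | rfl
  · exact hx0 (TwoSidedIdeal.mem_bot R |>.1 hx)
  · exact hy trivial

end SteinbergContracted

/-! ### Self-similar actions: words, idempotents and characters. -/

open Character

namespace SelfSimilarAction

variable {G X : Type*} [Group G] (σ : SelfSimilarAction G X)

theorem length_actWord (g : G) (w : List X) : (σ.actWord g w).length = w.length := by
  induction w generalizing g with
  | nil => rfl
  | cons x w ih => simp [actWord, ih]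

theorem map_fst_actWord_countableInflation (g : G) (w : List (X × ℕ)) :
    (σ.countableInflation.actWord g w).map Prod.fst = σ.actWord g (w.map Prod.fst) := by
  induction w generalizing g with
  | nil => rfl
  | cons x w ih => exact congrArg (List.cons (σ.act g x.1)) (ih (σ.sec g x.1))

variable {σ}

theorem Faithful.countableInflation (h : σ.Faithful) : σ.countableInflation.Faithful := by
  intro g hg
  refine h g fun w => ?_
  have h1 := congrArg (List.map Prod.fst) (hg (w.map fun x => (x, 0)))
  rwa [map_fst_actWord_countableInflation, List.map_map, Function.comp_def, List.map_id'] at h1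

end SelfSimilarAction

namespace SelfSimilarSemigroup

variable {G X : Type*} [Group G] {σ : SelfSimilarAction G X}

theorem elt_ne_zero (u v : List X) (g : G) : (elt u g v : SelfSimilarSemigroup σ) ≠ 0 := by
  intro h
  cases h

theorem elt_mul_elt (u v p z : List X) (g h : G) :
    (elt u g v : SelfSimilarSemigroup σ) * elt (v ++ p) h z =
      elt (u ++ σ.actWord g p) (σ.secWord g p * h) z := mul_of_prefix u v p z g h

theorem elt_mul_elt' (u w q z : List X) (g h : G) :
    (elt u g (w ++ q) : SelfSimilarSemigroup σ) * elt w h z =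
      elt u (g * σ.secWord h (σ.actWord h⁻¹ q)) (z ++ σ.actWord h⁻¹ q) :=
  mul_of_prefix' u w q z g h

theorem elt_mul_elt_same (u v z : List X) (g h : G) :
    (elt u g v : SelfSimilarSemigroup σ) * elt v h z = elt u (g * h) z := by
  simpa using elt_mul_elt (σ := σ) u v [] z g h

theorem elt_mul_elt_eq_zero {u v w z : List X} {g h : G} (h1 : ¬ v <+: w) (h2 : ¬ w <+: v) :
    (elt u g v : SelfSimilarSemigroup σ) * elt w h z = 0 := by
  change mul _ _ = zero
  simp [mul, h1, h2]

theorem star_elt (u v : List X) (g : G) :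
    star (elt u g v : SelfSimilarSemigroup σ) = elt v g⁻¹ u := rfl

theorem mul_one_elt (s : SelfSimilarSemigroup σ) : s * elt [] 1 [] = s := by
  cases s with
  | zero => rfl
  | elt u g v =>
    have := elt_mul_elt' (σ := σ) u [] v [] g 1
    simpa [σ.actWord_one, σ.secWord_one] using this

variable (σ) in
/-- The idempotent `w w^*`. -/
noncomputable def wordIdem (w : List X) : Idem (SelfSimilarSemigroup σ) :=
  ⟨elt w 1 w, by rw [elt_mul_elt_same, mul_one]⟩

theorem wordIdem_ne_zero (w : List X) : wordIdem σ w ≠ 0 :=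
  fun h => elt_ne_zero w w 1 (congrArg Subtype.val h)

theorem wordIdem_injective : Function.Injective (wordIdem σ) := by
  intro v w h
  have h' : (elt v 1 v : SelfSimilarSemigroup σ) = elt w 1 w := congrArg Subtype.val h
  injection h'

/-- An idempotent is its own inverse, which forces u = v; then g² = g gives g = 1. -/
theorem eq_zero_or_eq_wordIdem (e : Idem (SelfSimilarSemigroup σ)) :
    e = 0 ∨ ∃ w, e = wordIdem σ w := by
  obtain ⟨e, he⟩ := e
  cases e with
  | zero => exact Or.inl rfl
  | elt u g v =>
    right
    have h1 := star_idem he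
    rw [star_elt] at h1
    injection h1 with h1 h2 h3
    subst h1
    rw [elt_mul_elt_same] at he
    injection he with _ he _
    have : g = 1 := by simpa using he
    subst this
    exact ⟨v, rfl⟩

theorem wordIdem_mul_append (w p : List X) :
    wordIdem σ w * wordIdem σ (w ++ p) = wordIdem σ (w ++ p) := by
  refine Subtype.ext ?_
  change elt w 1 w * elt (w ++ p) 1 (w ++ p) = _
  rw [elt_mul_elt, σ.actWord_one, σ.secWord_one, mul_one]
  rfl

theorem wordIdem_mul_eq_zero {v w : List X} (h1 : ¬ v <+: w) (h2 : ¬ w <+: v) :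
    wordIdem σ v * wordIdem σ w = 0 :=
  Subtype.ext (elt_mul_elt_eq_zero h1 h2)

theorem wordIdem_mul_eq_iff {v w : List X} :
    wordIdem σ v * wordIdem σ w = wordIdem σ w ↔ v <+: w := by
  constructor
  · intro h
    by_contra h1
    by_cases h2 : w <+: v
    · obtain ⟨p, rfl⟩ := h2
      rw [mul_comm, wordIdem_mul_append] at h
      exact h1 ⟨[], by rw [List.append_nil, wordIdem_injective h]⟩
    · rw [wordIdem_mul_eq_zero h1 h2] at h
      exact wordIdem_ne_zero w h.symm
  · rintro ⟨p, rfl⟩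
    exact wordIdem_mul_append v p

theorem src_elt (u v : List X) (g : G) :
    src (elt u g v : SelfSimilarSemigroup σ) = wordIdem σ v := by
  refine Subtype.ext ?_
  change star (elt u g v) * elt u g v = _
  rw [star_elt, elt_mul_elt_same, inv_mul_cancel]
  rfl

/-- The action on characters in terms of prefixes: the image of θ under ugv* has the prefix u g(p)
exactly when θ has the prefix vp. -/
theorem conj_elt_wordIdem (u v p : List X) (g : G) :
    conj (elt u g v : SelfSimilarSemigroup σ) (wordIdem σ (u ++ σ.actWord g p)) =
      wordIdem σ (v ++ p) := by
  refine Subtype.ext ?_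
  change star (elt u g v) * elt (u ++ σ.actWord g p) 1 (u ++ σ.actWord g p) * elt u g v =
    elt (v ++ p) 1 (v ++ p)
  rw [star_elt, elt_mul_elt, elt_mul_elt', σ.actWord_inv_actWord, mul_one, σ.secWord_inv,
    inv_mul_cancel]

theorem apply_wordIdem_of_prefix {θ : Character (SelfSimilarSemigroup σ)} {v w : List X}
    (h : v <+: w) (hw : θ.toFun (wordIdem σ w) = true) : θ.toFun (wordIdem σ v) = true := by
  rw [← wordIdem_mul_eq_iff.2 h, θ.map_mul, Bool.and_eq_true] at hw
  exact hw.1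

theorem prefix_or_prefix_of_apply {θ : Character (SelfSimilarSemigroup σ)} {v w : List X}
    (hv : θ.toFun (wordIdem σ v) = true) (hw : θ.toFun (wordIdem σ w) = true) :
    v <+: w ∨ w <+: v := by
  by_contra h
  rw [not_or] at h
  have h1 := θ.map_mul (wordIdem σ v) (wordIdem σ w)
  rw [wordIdem_mul_eq_zero h.1 h.2, hv, hw, θ.map_zero] at h1
  exact Bool.false_ne_true h1

theorem exists_eq_wordIdem {θ : Character (SelfSimilarSemigroup σ)}
    {e : Idem (SelfSimilarSemigroup σ)} (he : θ.toFun e = true) : ∃ w, e = wordIdem σ w := by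
  refine (eq_zero_or_eq_wordIdem e).resolve_left ?_
  rintro rfl
  rw [θ.map_zero] at he
  exact Bool.false_ne_true he

theorem apply_wordIdem_nil (θ : Character (SelfSimilarSemigroup σ)) :
    θ.toFun (wordIdem σ []) = true := by
  obtain ⟨e, he⟩ := θ.nonzero
  obtain ⟨w, rfl⟩ := exists_eq_wordIdem he
  exact apply_wordIdem_of_prefix List.nil_prefix he

variable (σ) in
/-- The principal character of a word: it is `1` on the prefixes of the word. -/
noncomputable def wordCharacter (w : List X) : Character (SelfSimilarSemigroup σ) :=
  principal (wordIdem σ w) (wordIdem_ne_zero w)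

theorem wordCharacter_apply {v w : List X} :
    (wordCharacter σ w).toFun (wordIdem σ v) = true ↔ v <+: w := by
  rw [wordCharacter, principal_apply, mul_comm, wordIdem_mul_eq_iff]

variable (σ) in
-- Each member of F determines its word, hence at most one letter after w. With infinitely many
-- letters, some branch at w is not touched by F.
theorem finite_setOf_wordIdem_mem (w : List X) (F : Finset (Idem (SelfSimilarSemigroup σ))) :
    {x : X | ∃ r, wordIdem σ (w ++ x :: r) ∈ F}.Finite := by
  have h : (⋃ f ∈ F, {x : X | ∃ r, wordIdem σ (w ++ x :: r) = f}).Finite := by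
    refine F.finite_toSet.biUnion fun f _ => Set.Subsingleton.finite ?_
    rintro x ⟨r, rfl⟩ y ⟨r', h⟩
    have := List.append_cancel_left (wordIdem_injective h)
    simp only [List.cons.injEq] at this
    exact this.1.symm
  refine h.subset ?_
  rintro x ⟨r, hr⟩
  exact Set.mem_biUnion (x := wordIdem σ (w ++ x :: r)) hr ⟨r, rfl⟩

theorem exists_letter_forall_notMem [Infinite X] (w : List X)
    (F : Finset (Idem (SelfSimilarSemigroup σ))) : ∃ x, ∀ r, wordIdem σ (w ++ x :: r) ∉ F := by
  obtain ⟨x, hx⟩ := (finite_setOf_wordIdem_mem σ w F).exists_notMem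
  exact ⟨x, fun r hr => hx ⟨r, hr⟩⟩

/-- If a character through wx were 1 at the idempotent of a word z in F, then z would be comparable
with wx. Either z continues wx, which the choice of x excludes, or z is a prefix of w, which is
impossible since θ is 1 at w and 0 on F. -/
theorem support_subset_basicSet {θ : Character (SelfSimilarSemigroup σ)} {w : List X} {x : X}
    {F : Finset (Idem (SelfSimilarSemigroup σ))} (hθ : θ ∈ basicSet (wordIdem σ w) F)
    (hx : ∀ r, wordIdem σ (w ++ x :: r) ∉ F) :
    support (wordIdem σ (w ++ [x])) ⊆ basicSet (wordIdem σ w) F := by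
  intro η hη
  refine ⟨apply_wordIdem_of_prefix (List.prefix_append _ _) hη, fun f hf => ?_⟩
  rw [← Bool.not_eq_true]
  intro h
  obtain ⟨z, rfl⟩ := exists_eq_wordIdem h
  rcases prefix_or_prefix_of_apply h hη with h1 | ⟨r, rfl⟩
  · rcases List.prefix_concat_iff.1 h1 with rfl | h1
    · exact hx [] hf
    · have := hθ.2 _ hf
      rw [apply_wordIdem_of_prefix h1 hθ.1] at this
      exact Bool.false_ne_true this.symm
  · refine hx r ?_
    rwa [List.append_assoc] at hf

/-! ### Congruence-freeness and strong 0-disjunctivity. -/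

/-- The compression w* · w fixes 1, so it suffices to find w with w* t w = 0. If t = pkq* with p or
q non-empty, a letter different from its first one works; if t = k ≠ 1 is in G, any word moved by k
works. -/
theorem congr_one_zero (hσ : σ.Faithful) [Nontrivial X] (c : Con (SelfSimilarSemigroup σ))
    {t : SelfSimilarSemigroup σ} (ht : t ≠ elt [] 1 []) (h : c (elt [] 1 []) t) :
    c (elt [] 1 []) 0 := by
  have key : ∀ w : List X, elt [] 1 w * t * elt w 1 [] = 0 → c (elt [] 1 []) 0 := by
    intro w hw
    have h1 := c.mul (c.mul (c.refl (elt [] 1 w)) h) (c.refl (elt w 1 []))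
    rwa [hw, mul_one_elt, elt_mul_elt_same, mul_one] at h1
  have single : ∀ {x y : X} {r : List X}, x ≠ y → ¬ [x] <+: y :: r ∧ ¬ (y :: r) <+: [x] := by
    intro x y r hxy
    constructor
    · rintro ⟨l, hl⟩
      simp only [List.cons_append, List.cons.injEq] at hl
      exact hxy hl.1
    · rintro ⟨l, hl⟩
      simp only [List.cons_append, List.cons.injEq] at hl
      exact hxy hl.1.symm
  cases t with
  | zero => exact h
  | elt p k q =>
    cases p with
    | cons y p =>
      obtain ⟨x, hx⟩ := exists_ne y
      refine key [x] ?_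
      rw [elt_mul_elt_eq_zero (single hx).1 (single hx).2, zero_mul]
    | nil =>
      cases q with
      | cons y q =>
        obtain ⟨x, hx⟩ := exists_ne y
        refine key [x] ?_
        rw [mul_assoc, elt_mul_elt_eq_zero (single hx).2 (single hx).1, mul_zero]
      | nil =>
        have hk : k ≠ 1 := by
          rintro rfl
          exact ht rfl
        have hw : ∃ w, σ.actWord k w ≠ w := by
          by_contra hw
          push Not at hw
          exact hk (hσ k hw)
        obtain ⟨w, hw⟩ := hw
        refine key w ?_
        have h1 := elt_mul_elt (σ := σ) [] [] w [] k 1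
        rw [List.nil_append, List.nil_append] at h1
        rw [mul_assoc, h1, elt_mul_elt_eq_zero]
        · exact fun h => hw (h.eq_of_length (σ.length_actWord k w).symm).symm
        · exact fun h => hw (h.eq_of_length (σ.length_actWord k w))

/-- Multiplying s = ugv* by g⁻¹u* on the left and by v on the right turns it into 1. If t were
turned into 1 as well, its graph would contain that of s. -/
theorem congr_one_zero_of_graph (hσ : σ.Faithful) [Nontrivial X]
    (c : Con (SelfSimilarSemigroup σ)) {s t : SelfSimilarSemigroup σ} (h : c s t)
    {m n : List X × G} (hs : s.Graph m n) (ht : ¬ t.Graph m n) : c (elt [] 1 []) 0 := by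
  cases s with
  | zero => exact hs.elim
  | elt u g v =>
    have h1 := c.mul (c.mul (c.refl (elt [] g⁻¹ u)) h) (c.refl (elt v 1 []))
    rw [elt_mul_elt_same, elt_mul_elt_same, inv_mul_cancel, mul_one] at h1
    refine congr_one_zero hσ c ?_ h1
    intro h2
    apply ht
    obtain ⟨p, k, rfl, rfl⟩ := hs
    have h3 : (elt [] 1 [] : SelfSimilarSemigroup σ).Graph (p, k) (p, k) :=
      ⟨p, k, rfl, by simp [σ.actWord_one, σ.secWord_one]⟩
    rw [← h2] at h3
    obtain ⟨l, h4, h5⟩ := (graph_mul _ _ _ _).1 h3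
    obtain ⟨l', h6, h7⟩ := (graph_mul _ _ _ _).1 h5
    have h8 : l = (v ++ p, k) := graph_functional h4
      ⟨p, k, rfl, by simp [σ.actWord_one, σ.secWord_one]⟩
    have h9 : l' = (u ++ σ.actWord g p, σ.secWord g p * k) := graph_injective h7
      ⟨σ.actWord g p, σ.secWord g p * k, rfl, by
        rw [σ.actWord_inv_actWord, σ.secWord_inv, inv_mul_cancel_left, List.nil_append]⟩
    rwa [h8, h9] at h6

theorem congruenceFree (hσ : σ.Faithful) [Nontrivial X] :
    CongruenceFree (SelfSimilarSemigroup σ) := by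
  intro c
  by_cases h : ∀ s t, c s t → s = t
  · exact Or.inl (eq_bot_iff.2 fun s t hst => h s t hst)
  · right
    push Not at h
    obtain ⟨s, t, hst, hne⟩ := h
    have h10 : c (elt [] 1 []) 0 := by
      by_contra h0
      refine hne (graph_ext fun m n => ⟨fun hs => ?_, fun ht => ?_⟩)
      · by_contra ht
        exact h0 (congr_one_zero_of_graph hσ c hst hs ht)
      · by_contra hs
        exact h0 (congr_one_zero_of_graph hσ c (c.symm hst) ht hs)
    have h0 : ∀ s, c s 0 := fun s => by
      have := c.mul (c.refl s) h10
      rwa [mul_one_elt, mul_zero] at this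
    exact eq_top_iff.2 fun s t _ => c.trans (h0 s) (c.symm (h0 t))

theorem stronglyZeroDisjunctive [Infinite X] :
    StronglyZeroDisjunctive (SelfSimilarSemigroup σ) := by
  intro e F he hF
  obtain ⟨w, rfl⟩ := (eq_zero_or_eq_wordIdem e).resolve_left he
  obtain ⟨x, hx⟩ := exists_letter_forall_notMem w F
  refine ⟨wordIdem σ (w ++ [x]), wordIdem_ne_zero _, ?_, fun f hf => ?_⟩
  · rw [mul_comm, wordIdem_mul_append]
  · rcases eq_zero_or_eq_wordIdem f with rfl | ⟨z, rfl⟩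
    · exact Subtype.ext (mul_zero _)
    · obtain ⟨h1, h2⟩ := hF _ hf
      rw [mul_comm, wordIdem_mul_eq_iff] at h1
      refine wordIdem_mul_eq_zero ?_ ?_
      · rintro ⟨r, rfl⟩
        refine hx r ?_
        rwa [List.append_assoc] at hf
      · intro h3
        rcases List.prefix_concat_iff.1 h3 with rfl | h3
        · exact hx [] hf
        · exact h2 (congrArg _ (h3.eq_of_length_le h1.length_le))

/-! ### Countability and minimality. -/

instance [Countable G] [Countable X] : Countable (SelfSimilarSemigroup σ) := by
  let f : SelfSimilarSemigroup σ → Option (List X × G × List X) := fun s =>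
    match s with
    | zero => none
    | elt u g v => some (u, g, v)
  refine Function.Injective.countable (f := f) ?_
  intro s t h
  cases s <;> cases t <;> simp_all [f]

theorem isMinimalGroupoid [Infinite X] :
    IsMinimalGroupoid (UniversalGroupoid (SelfSimilarSemigroup σ)) := by
  intro V hV hinv
  refine V.eq_empty_or_nonempty.imp_right ?_
  rintro ⟨a, ha⟩
  let φ := unitSpaceHomeomorph (SelfSimilarSemigroup σ)
  have ha' : φ.symm a ∈ φ ⁻¹' V := by rwa [Set.mem_preimage, φ.apply_symm_apply]
  obtain ⟨e, F, h1, h2⟩ := exists_basicSet (hV.preimage φ.continuous) ha'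
  obtain ⟨w, rfl⟩ := exists_eq_wordIdem h1.1
  obtain ⟨x, hx⟩ := exists_letter_forall_notMem w F
  have h3 := (support_subset_basicSet h1 hx).trans h2
  refine Set.eq_univ_of_forall fun b => ?_
  obtain ⟨θ, rfl⟩ := φ.surjective b
  have hθ : θ.toFun (src (elt (w ++ [x]) 1 [] : SelfSimilarSemigroup σ)) = true := by
    rw [src_elt]
    exact apply_wordIdem_nil θ
  -- Prepending wx is defined at every θ and lands in the cylinder of wx, which lies in V.
  refine (hinv (germ _ θ hθ)).2 (h3 ?_ : φ (θ.act _ hθ) ∈ V)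
  change θ.toFun (conj _ (wordIdem σ (w ++ [x]))) = true
  have := conj_elt_wordIdem (σ := σ) (w ++ [x]) [] [] 1
  rw [σ.actWord_nil, List.append_nil, List.append_nil] at this
  rw [this]
  exact apply_wordIdem_nil θ

end SelfSimilarSemigroup

/-! ### Effectiveness. -/

theorem unitSpace_subset_interior_isotropy (S : Type*) [InverseSemigroupWithZero S] :
    unitSpace (UniversalGroupoid S) ⊆ interior (isotropy (UniversalGroupoid S)) := by
  rintro _ ⟨a, rfl⟩
  obtain ⟨e, he⟩ := a.source.nonzero
  have he' : a.source.toFun (src e.1) = true := by rwa [src_idem]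
  refine mem_interior.2 ⟨germSet e.1 Set.univ, ?_, isOpen_germSet _ isOpen_univ, ?_⟩
  · rintro _ ⟨θ, h, -, rfl⟩
    rw [unitGerm_eq]
    change unitGerm (unitGerm θ).source = unitGerm (unitGerm θ).target
    rw [source_unitGerm, target_unitGerm]
  · exact ⟨_, he', trivial, (unitGerm_eq _ e he').symm⟩

namespace SelfSimilarSemigroup

section Isotropy

variable {G X : Type*} [Group G] {σ : SelfSimilarAction G X}

/-- At the character of the finite word vpq, ugv* produces the word u g(pq); if the character is
fixed, this must be one of its prefixes. -/
theorem prefix_of_isotropy {u v p q : List X} {g : G}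
    (h : (wordCharacter σ (v ++ (p ++ q))).toFun
      (src (elt u g v : SelfSimilarSemigroup σ)) = true)
    (hiso : (wordCharacter σ (v ++ (p ++ q))).act (elt u g v) h =
      wordCharacter σ (v ++ (p ++ q))) :
    u ++ σ.actWord g p ++ σ.actWord (σ.secWord g p) q <+: v ++ p ++ q := by
  rw [List.append_assoc, List.append_assoc, ← σ.actWord_append, ← wordCharacter_apply (σ := σ)]
  rw [← hiso]
  change (wordCharacter σ (v ++ (p ++ q))).toFun
    (conj (elt u g v) (wordIdem σ (u ++ σ.actWord g (p ++ q)))) = true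
  rw [conj_elt_wordIdem, wordCharacter_apply]

/-- If neither uy nor uy' reached the last letter, both would be prefixes of w of the same length,
and y = y'. -/
theorem eq_of_append_singleton_prefix {u w : List X} {x x' y y' : X} (hy : y ≠ y')
    (h : u ++ [y] <+: w ++ [x]) (h' : u ++ [y'] <+: w ++ [x']) : u = w := by
  rcases List.prefix_concat_iff.1 h with h | h
  · exact (List.append_inj' h rfl).1
  rcases List.prefix_concat_iff.1 h' with h' | h'
  · exact (List.append_inj' h' rfl).1
  have := (List.prefix_of_prefix_length_le h h' (by simp)).eq_of_length (by simp)
  simp only [List.append_cancel_left_eq, List.cons.injEq, and_true] at this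
  exact (hy this).elim

end Isotropy

variable {G A : Type*} [Group G] {σ : SelfSimilarAction G A}

theorem isEffectiveGroupoid_countableInflation [Nontrivial A] (hσ : σ.Faithful) :
    IsEffectiveGroupoid (UniversalGroupoid (SelfSimilarSemigroup σ.countableInflation)) := by
  refine Set.Subset.antisymm ?_ (unitSpace_subset_interior_isotropy _)
  intro a ha
  obtain ⟨s, θ, h, rfl⟩ := germ_surj a
  obtain ⟨e, F, h1, h2, h3⟩ := exists_germSet_basicSet_subset isOpen_interior ha
  replace h3 := h3.trans interior_subset
  cases s with
  | zero => exact ((Set.ext_iff.1 (germSet_zero Set.univ) _).1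
      (germ_mem_germSet_self (h := h) trivial)).elim
  | elt u g v =>
    obtain ⟨w, rfl⟩ := exists_eq_wordIdem h1.1
    have hv := h
    rw [src_elt] at hv
    -- Take the longer of the comparable words v and w, so that the cylinder lies in the domain of
    -- ugv* and below w.
    obtain ⟨w', hvw, hw', hww'⟩ : ∃ w', v <+: w' ∧
        θ.toFun (wordIdem σ.countableInflation w') = true ∧ w <+: w' := by
      rcases prefix_or_prefix_of_apply hv h1.1 with h4 | h4
      · exact ⟨w, h4, h1.1, List.prefix_rfl⟩
      · exact ⟨v, List.prefix_rfl, hv, h4⟩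
    obtain ⟨p, rfl⟩ := hvw
    have hθ : θ ∈ basicSet (wordIdem σ.countableInflation (v ++ p)) F := ⟨hw', h1.2⟩
    have hsub : basicSet (wordIdem σ.countableInflation (v ++ p)) F ⊆
        basicSet (wordIdem σ.countableInflation w) F :=
      fun η hη => ⟨apply_wordIdem_of_prefix hww' hη.1, hη.2⟩
    -- A level n at which no letter following vp is touched by F. The inflation thus makes all
    -- letters of A available at once, as the test of k on words over A requires.
    obtain ⟨n, hn⟩ := ((finite_setOf_wordIdem_mem σ.countableInflation (v ++ p) F).image
      Prod.snd).exists_notMem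
    have key : ∀ (x : A) (z : List (A × ℕ)),
        u ++ σ.countableInflation.actWord g p ++
          σ.countableInflation.actWord (σ.countableInflation.secWord g p) ((x, n) :: z) <+:
          v ++ p ++ (x, n) :: z := by
      intro x z
      have hm : wordCharacter σ.countableInflation (v ++ (p ++ (x, n) :: z)) ∈
          basicSet (wordIdem σ.countableInflation w) F := by
        refine hsub (support_subset_basicSet (x := (x, n)) hθ
          (fun r hr => hn ⟨(x, n), ⟨r, hr⟩, rfl⟩) ?_)
        exact wordCharacter_apply.2 ⟨z, by simp⟩
      have hiso := h3 (germ_mem_germSet_self (h := h2 hm) hm)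
      exact prefix_of_isotropy (h2 hm) (unitGerm_inj.1 hiso).symm
    obtain ⟨x, y, hxy⟩ := exists_pair_ne A
    generalize hk : σ.countableInflation.secWord g p = k at key
    -- Two distinct letters at level n have distinct images under k, so the words u g(p) and vp must
    -- end at the same place.
    have hu : u ++ σ.countableInflation.actWord g p = v ++ p := by
      refine eq_of_append_singleton_prefix ?_ (key x []) (key y [])
      intro h4
      have h5 := congrArg (fun l => σ.countableInflation.actWord k⁻¹ [l]) h4
      have h6 : σ.countableInflation.actWord k⁻¹ (σ.countableInflation.actWord k [(x, n)]) =
        σ.countableInflation.actWord k⁻¹ (σ.countableInflation.actWord k [(y, n)]) := h5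
      rw [SelfSimilarAction.actWord_inv_actWord, SelfSimilarAction.actWord_inv_actWord] at h6
      simp only [List.cons.injEq, Prod.mk.injEq, and_true] at h6
      exact hxy h6
    have hk1 : k = 1 := by
      refine hσ k fun z => ?_
      cases z with
      | nil => rfl
      | cons x z =>
        -- Only the first letter must sit at level n; later levels are arbitrary, and projecting to
        -- A forgets them.
        have h4 := key x (z.map fun y => (y, 0))
        rw [hu, List.prefix_append_right_inj] at h4
        have h5 := h4.eq_of_length (SelfSimilarAction.length_actWord _ _ _)
        have h6 := congrArg (List.map Prod.fst) h5
        rwa [SelfSimilarAction.map_fst_actWord_countableInflation, List.map_cons, List.map_map,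
          Function.comp_def, List.map_id'] at h6
    subst hk1
    have h7 : germ (elt u g v) θ h = unitGerm θ := by
      rw [← unitGerm_eq θ (wordIdem _ (v ++ p)) (by rwa [src_idem])]
      refine germ_eq_iff.2 ⟨rfl, wordIdem _ (v ++ p), hw', ?_⟩
      change elt u g v * elt (v ++ p) 1 (v ++ p) =
        elt (v ++ p) 1 (v ++ p) * elt (v ++ p) 1 (v ++ p)
      rw [elt_mul_elt, elt_mul_elt_same, hk, hu]
    rw [h7]
    exact unitGerm_mem_unitSpace θ

variable (K : Type*) [Field K]

/-! ### The singular element and the ideal over infinite words. -/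

section Singular

variable {X : Type*} {τ : SelfSimilarAction G X}

/-- If g fixes the letter x, then g · xx* = x g|_x x*. Over the cylinder of x its germs therefore
depend only on the section at x. -/
theorem germChar_apply_eq_of_sec_eq {g k : G} {x : X} (hg : g ∈ τ.stabOne) (hk : k ∈ τ.stabOne)
    (hs : τ.sec g x = τ.sec k x) {γ : UniversalGroupoid (SelfSimilarSemigroup τ)}
    (hγ : γ.source.toFun (wordIdem τ [x]) = true) :
    (germChar K (elt [] g [] : SelfSimilarSemigroup τ)).1 γ =
      (germChar K (elt [] k [] : SelfSimilarSemigroup τ)).1 γ := by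
  have h : ∀ g ∈ τ.stabOne, (elt [] g [] : SelfSimilarSemigroup τ) * (wordIdem τ [x]).1 =
      elt [x] (τ.sec g x) [x] := by
    intro g hg
    have h1 := elt_mul_elt (σ := τ) [] [] [x] [x] g 1
    have h2 : τ.act g x = x := hg x
    change elt [] g [] * elt [x] 1 [x] = _
    simpa [SelfSimilarAction.actWord, SelfSimilarAction.secWord, h2] using h1
  have h2 : γ ∈ germSet (elt [] g [] : SelfSimilarSemigroup τ) Set.univ ↔
      γ ∈ germSet (elt [] k [] : SelfSimilarSemigroup τ) Set.univ := by
    have h3 := germSet_inter_source_support (elt [] g []) (wordIdem τ [x])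
    rw [h g hg, hs, ← h k hk, ← germSet_inter_source_support] at h3
    have h4 := Set.ext_iff.1 h3 γ
    have h5 : γ ∈ UniversalGroupoid.source ⁻¹' support (wordIdem τ [x]) := hγ
    simpa only [Set.mem_inter_iff, h5, and_true] using h4
  change charFun K _ γ = charFun K _ γ
  by_cases hm : γ ∈ germSet (elt [] g [] : SelfSimilarSemigroup τ) Set.univ
  · rw [charFun, charFun, Set.indicator_of_mem hm, Set.indicator_of_mem (h2.1 hm)]
  · rw [charFun, charFun, Set.indicator_of_notMem hm, Set.indicator_of_notMem (mt h2.2 hm)]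

/-- The element `1 - p - q + pq` of the Steinberg algebra, for `p`, `q` in the group. -/
noncomputable def commutingProduct (p q : G) :
    SteinbergAlgebra (UniversalGroupoid (SelfSimilarSemigroup τ)) K :=
  germChar K (elt [] 1 []) - germChar K (elt [] p []) - germChar K (elt [] q []) +
    germChar K (elt [] (p * q) [])

theorem commutingProduct_apply (p q : G) (γ : UniversalGroupoid (SelfSimilarSemigroup τ)) :
    (commutingProduct K p q).1 γ = (germChar K (elt [] 1 [] : SelfSimilarSemigroup τ)).1 γ -
      (germChar K (elt [] p [] : SelfSimilarSemigroup τ)).1 γ -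
      (germChar K (elt [] q [] : SelfSimilarSemigroup τ)).1 γ +
      (germChar K (elt [] (p * q) [] : SelfSimilarSemigroup τ)).1 γ := rfl

/-- Let x be the first letter of w. If p|_x = 1, the terms of 1 and p cancel over x, and so do those
of q and pq; if q|_x = 1, the pairs are 1 with q and p with pq. -/
theorem commutingProduct_apply_eq_zero {p q : G} (hp : p ∈ τ.stabOne) (hq : q ∈ τ.stabOne)
    (hpq : ∀ x, τ.sec p x = 1 ∨ τ.sec q x = 1)
    {γ : UniversalGroupoid (SelfSimilarSemigroup τ)} {w : List X} (hw : w ≠ [])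
    (hγ : γ.source.toFun (wordIdem τ w) = true) : (commutingProduct K p q).1 γ = 0 := by
  obtain ⟨x, w, rfl⟩ := List.exists_cons_of_ne_nil hw
  have hx : γ.source.toFun (wordIdem τ [x]) = true :=
    apply_wordIdem_of_prefix (List.prefix_append [x] w) hγ
  have hmul : τ.sec (p * q) x = τ.sec p x * τ.sec q x := by
    rw [τ.mul_sec, show τ.act q x = x from hq x]
  have h1 := τ.stabOne.one_mem
  have h2 := τ.stabOne.mul_mem hp hq
  rw [commutingProduct_apply]
  rcases hpq x with h | h
  · rw [germChar_apply_eq_of_sec_eq K h1 hp (by rw [h, τ.one_sec]) hx,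
      germChar_apply_eq_of_sec_eq K h2 hq (by rw [hmul, h, one_mul]) hx]
    ring
  · rw [germChar_apply_eq_of_sec_eq K h1 hq (by rw [h, τ.one_sec]) hx,
      germChar_apply_eq_of_sec_eq K h2 hp (by rw [hmul, h, mul_one]) hx]
    ring

theorem germChar_one_apply (θ : Character (SelfSimilarSemigroup τ))
    (h : θ.toFun (src (elt [] 1 [] : SelfSimilarSemigroup τ)) = true) :
    (germChar K (elt [] 1 [] : SelfSimilarSemigroup τ)).1 (germ _ θ h) = 1 :=
  Set.indicator_of_mem (show germ _ θ h ∈ germSet _ Set.univ from germ_mem_germSet_self trivial) _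

/-- At the empty word, the only idempotent with value 1 is the identity, so distinct group elements
have distinct germs there, and at the germ of 1 only the first term survives. -/
theorem commutingProduct_ne_zero {p q : G} (hp : p ≠ 1) (hq : q ≠ 1) (hpq : p * q ≠ 1) :
    commutingProduct (τ := τ) K p q ≠ 0 := by
  intro h
  have h1 : (commutingProduct K p q).1
      (principalGerm (elt [] 1 [] : SelfSimilarSemigroup τ) (elt_ne_zero _ _ _)) = 0 := by
    rw [h]
    rfl
  have h2 : ∀ g : G, g ≠ 1 → (germChar K (elt [] g [] : SelfSimilarSemigroup τ)).1
      (principalGerm (elt [] 1 [] : SelfSimilarSemigroup τ) (elt_ne_zero _ _ _)) = 0 := by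
    intro g hg
    refine Set.indicator_of_notMem (fun hm => hg ?_) _
    have h3 := eq_mul_src_of_principalGerm_mem hm
    rw [src_elt] at h3
    change elt [] 1 [] = elt [] g [] * elt [] 1 [] at h3
    rw [elt_mul_elt_same, mul_one] at h3
    injection h3 with _ h3 _
    exact h3.symm
  rw [commutingProduct_apply, h2 p hp, h2 q hq, h2 _ hpq, sub_zero, sub_zero, add_zero] at h1
  exact one_ne_zero ((germChar_one_apply K _ _).symm.trans h1)

/-- Any non-empty open set of germs contains one whose source is a finite word wx, which is
non-empty, and f vanishes there. -/
theorem isSingularFunction_of_apply_eq_zero [Infinite X]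
    {f : SteinbergAlgebra (UniversalGroupoid (SelfSimilarSemigroup τ)) K}
    (hf : ∀ (γ : UniversalGroupoid (SelfSimilarSemigroup τ)) (w : List X), w ≠ [] →
      γ.source.toFun (wordIdem τ w) = true → f.1 γ = 0) : IsSingularFunction f := by
  refine Set.eq_empty_of_forall_notMem fun γ hγ => ?_
  obtain ⟨s, θ, h, rfl⟩ := germ_surj γ
  obtain ⟨e, F, h1, h2, h3⟩ := exists_germSet_basicSet_subset isOpen_interior hγ
  obtain ⟨w, rfl⟩ := exists_eq_wordIdem h1.1
  obtain ⟨x, hx⟩ := exists_letter_forall_notMem w F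
  have hm : wordCharacter τ (w ++ [x]) ∈ basicSet (wordIdem τ w) F :=
    support_subset_basicSet h1 hx (wordCharacter_apply.2 List.prefix_rfl)
  have h4 := interior_subset (h3 (germ_mem_germSet_self (h := h2 hm) hm))
  exact h4 (hf _ (w ++ [x]) (by simp) (wordCharacter_apply.2 List.prefix_rfl))

variable (τ) in
/-- The characters given by infinite words. -/
def infiniteCharacters : Set (Character (SelfSimilarSemigroup τ)) :=
  {θ | ∀ n, ∃ w : List X, n ≤ w.length ∧ θ.toFun (wordIdem τ w) = true}

/-- A germ of ugv* replaces the prefix v by u, so a prefix of length at least n + |v| of the source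
yields one of length at least n of the target. -/
theorem target_mem_infiniteCharacters (γ : UniversalGroupoid (SelfSimilarSemigroup τ))
    (h : γ.source ∈ infiniteCharacters τ) : γ.target ∈ infiniteCharacters τ := by
  intro n
  obtain ⟨s, θ, hθ, rfl⟩ := germ_surj γ
  cases s with
  | zero => exact ((Set.ext_iff.1 (germSet_zero Set.univ) _).1
      (germ_mem_germSet_self (h := hθ) trivial)).elim
  | elt u g v =>
    obtain ⟨w, hn, hw⟩ := h (n + v.length)
    have hv := hθ
    rw [src_elt] at hv
    have hp : v <+: w := by
      rcases prefix_or_prefix_of_apply hv hw with h1 | h1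
      · exact h1
      · have := h1.length_le
        exact (h1.eq_of_length (by omega)) ▸ List.prefix_rfl
    obtain ⟨p, rfl⟩ := hp
    refine ⟨u ++ τ.actWord g p, ?_, ?_⟩
    · rw [List.length_append] at hn ⊢
      rw [τ.length_actWord]
      omega
    · change θ.toFun (conj (elt u g v) _) = true
      rw [conj_elt_wordIdem]
      exact hw

/-- The cylinders of the powers of one letter form a decreasing sequence of non-empty compact sets.
-/
theorem nonempty_infiniteCharacters [Nonempty X] : (infiniteCharacters τ).Nonempty := by
  obtain ⟨x⟩ := ‹Nonempty X›
  obtain ⟨θ, hθ⟩ := IsCompact.nonempty_iInter_of_sequence_nonempty_isCompact_isClosed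
    (fun n => support (wordIdem τ (List.replicate n x)))
    (fun n θ hθ => apply_wordIdem_of_prefix (List.prefix_replicate_iff.2 ⟨by simp, by simp⟩) hθ)
    (fun n => ⟨wordCharacter τ _, wordCharacter_apply.2 List.prefix_rfl⟩)
    (isCompact_support _) (fun n => (isClopen_support _).1)
  rw [Set.mem_iInter] at hθ
  exact ⟨θ, fun n => ⟨_, by rw [List.length_replicate], hθ n⟩⟩

variable (τ) in
/-- The ideal of functions vanishing on the germs at infinite words. -/
noncomputable def infiniteVanishingIdeal :
    TwoSidedIdeal (SteinbergAlgebra (UniversalGroupoid (SelfSimilarSemigroup τ)) K) :=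
  vanishingIdeal K (infiniteCharacters τ) target_mem_infiniteCharacters

theorem germChar_one_notMem_infiniteVanishingIdeal [Nonempty X] :
    germChar K (elt [] 1 []) ∉ infiniteVanishingIdeal K τ := by
  intro h
  obtain ⟨θ, hθ⟩ := nonempty_infiniteCharacters (τ := τ)
  have h1 : θ.toFun (src (elt [] 1 [] : SelfSimilarSemigroup τ)) = true := by
    rw [src_elt]
    exact apply_wordIdem_nil θ
  have h2 := mem_vanishingIdeal.1 h (germ _ θ h1) hθ
  exact one_ne_zero ((germChar_one_apply K θ h1).symm.trans h2)

theorem mem_infiniteVanishingIdeal_of_apply_eq_zero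
    {f : SteinbergAlgebra (UniversalGroupoid (SelfSimilarSemigroup τ)) K}
    (hf : ∀ (γ : UniversalGroupoid (SelfSimilarSemigroup τ)) (w : List X), w ≠ [] →
      γ.source.toFun (wordIdem τ w) = true → f.1 γ = 0) : f ∈ infiniteVanishingIdeal K τ := by
  refine mem_vanishingIdeal.2 fun γ hγ => ?_
  obtain ⟨w, hn, hw⟩ := hγ 1
  exact hf γ w (List.ne_nil_of_length_pos hn) hw

end Singular

/-! ### The branch condition and the conclusion. -/

theorem exists_ne_zero_apply_eq_zero [Nontrivial A] (hσ : σ.IsWeaklyRegularBranch) :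
    ∃ f : SteinbergAlgebra (UniversalGroupoid (SelfSimilarSemigroup σ.countableInflation)) K,
      f ≠ 0 ∧ ∀ (γ : UniversalGroupoid (SelfSimilarSemigroup σ.countableInflation))
        (w : List (A × ℕ)), w ≠ [] →
        γ.source.toFun (wordIdem σ.countableInflation w) = true → f.1 γ = 0 := by
  classical
  obtain ⟨H, hH, hne, hsec⟩ := hσ.branches
  obtain ⟨⟨h, hh⟩, h1⟩ := Subgroup.ne_bot_iff_exists_ne_one.1 hne
  replace h1 : h ≠ 1 := fun h0 => h1 (Subtype.ext h0)
  obtain ⟨a, b, hab⟩ := exists_pair_ne A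
  -- For distinct letters a and b these elements have disjoint supports on the first level. There p
  -- has section h at a, q has section h at b, and pq still has section h at a, so none of the three
  -- is 1.
  have hex : ∀ c : A, ∃ p ∈ H, ∀ x, σ.sec p x = if x = c then h else 1 := by
    intro c
    refine hsec _ fun x => ?_
    split_ifs
    · exact hh
    · exact H.one_mem
  obtain ⟨p, hp, hpa⟩ := hex a
  obtain ⟨q, hq, hqb⟩ := hex b
  refine ⟨commutingProduct K p q, commutingProduct_ne_zero K ?_ ?_ ?_, fun γ w hw hγ =>
    commutingProduct_apply_eq_zero K ?_ ?_ ?_ hw hγ⟩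
  · rintro rfl
    have := hpa a
    rw [if_pos rfl, σ.one_sec] at this
    exact h1 this.symm
  · rintro rfl
    have := hqb b
    rw [if_pos rfl, σ.one_sec] at this
    exact h1 this.symm
  · intro h0
    have := σ.mul_sec p q a
    rw [h0, σ.one_sec, show σ.act q a = a from hH hq a, hpa, hqb, if_pos rfl, if_neg hab,
      mul_one] at this
    exact h1 this.symm
  · exact fun x => Prod.ext (hH hp x.1) rfl
  · exact fun x => Prod.ext (hH hq x.1) rfl
  · intro x
    change σ.sec p x.1 = 1 ∨ σ.sec q x.1 = 1
    rw [hpa, hqb]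
    by_cases hx : x.1 = a
    · exact Or.inr (if_neg (hx ▸ hab))
    · exact Or.inl (if_neg hx)

end SelfSimilarSemigroup

end BranchGroupoid

open BranchGroupoid

theorem mainTheorem11 {G A : Type*} [Group G] [Finite A] [Nontrivial A]
    (σ : SelfSimilarAction G A) (hσ : σ.IsWeaklyRegularBranch) :
    InverseSemigroupWithZero.CongruenceFree (SelfSimilarSemigroup σ.countableInflation) ∧
    InverseSemigroupWithZero.StronglyZeroDisjunctive
      (SelfSimilarSemigroup σ.countableInflation) ∧
    ∃ _ : IsAmpleGroupoid (UniversalGroupoid (SelfSimilarSemigroup σ.countableInflation)),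
      (Countable G → SecondCountableTopology
        (UniversalGroupoid (SelfSimilarSemigroup σ.countableInflation))) ∧
      IsMinimalGroupoid (UniversalGroupoid (SelfSimilarSemigroup σ.countableInflation)) ∧
      IsEffectiveGroupoid (UniversalGroupoid (SelfSimilarSemigroup σ.countableInflation)) ∧
      ∀ (K : Type*) [Field K],
        (∃ f : SteinbergAlgebra (UniversalGroupoid (SelfSimilarSemigroup σ.countableInflation)) K,
          f ≠ 0 ∧ IsSingularFunction f) ∧
        (∃ Φ : ContractedAlgebra K (SelfSimilarSemigroup σ.countableInflation) →ₙₐ[K]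
            SteinbergAlgebra (UniversalGroupoid (SelfSimilarSemigroup σ.countableInflation)) K,
          Function.Bijective Φ) ∧
        ¬ IsSimpleRing (ContractedAlgebra K (SelfSimilarSemigroup σ.countableInflation)) ∧
        ¬ IsSimpleRing
          (SteinbergAlgebra (UniversalGroupoid (SelfSimilarSemigroup σ.countableInflation)) K) := by
  refine ⟨SelfSimilarSemigroup.congruenceFree hσ.faithful.countableInflation,
    SelfSimilarSemigroup.stronglyZeroDisjunctive, inferInstance,
    fun _ => secondCountableTopology_universalGroupoid,
    SelfSimilarSemigroup.isMinimalGroupoid,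
    SelfSimilarSemigroup.isEffectiveGroupoid_countableInflation hσ.faithful, ?_⟩
  intro K _
  obtain ⟨f, hf0, hf⟩ := SelfSimilarSemigroup.exists_ne_zero_apply_eq_zero K hσ
  have hmem := SelfSimilarSemigroup.mem_infiniteVanishingIdeal_of_apply_eq_zero K hf
  have hnot := SelfSimilarSemigroup.germChar_one_notMem_infiniteVanishingIdeal
    (τ := σ.countableInflation) K
  have hbij := germHom_bijective (S := SelfSimilarSemigroup σ.countableInflation) (K := K)
  refine ⟨⟨f, hf0, SelfSimilarSemigroup.isSingularFunction_of_apply_eq_zero K hf⟩,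
    ⟨germHom _ K, hbij⟩, ?_, not_isSimpleRing_of_mem_of_notMem _ hmem hf0 hnot⟩
  obtain ⟨x, rfl⟩ := hbij.2 f
  obtain ⟨y, hy⟩ := hbij.2 (germChar K (SelfSimilarSemigroup.elt [] 1 []))
  rw [← hy] at hnot
  -- The ideal is pulled back along the isomorphism; x and y are the preimages of the singular
  -- function and of the identity.
  refine not_isSimpleRing_of_mem_of_notMem (x := x) (y := y)
    ((SelfSimilarSemigroup.infiniteVanishingIdeal K σ.countableInflation).comap (germHom _ K))
    ((TwoSidedIdeal.mem_comap _).2 hmem) ?_ fun h => hnot ((TwoSidedIdeal.mem_comap _).1 h)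
  rintro rfl
  exact hf0 (_root_.map_zero (germHom _ K))
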